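/- Let $1\le k\le n$ be integers and let $\Omega\subset\mathbb R^n$ be a bounded open set. For a $C^2$ function $v$ put $A_{ij}(v)=v\,v_{ij}-\tfrac12|\nabla v|^2\delta_{ij}$ and, for $j\ge0$, $S_j(v)=\sigma_j(\lambda\{A(v)\})$, where $\lambda\{A(v)\}=(\lambda_1,\dots,\lambda_n)$ are the eigenvalues of the symmetric matrix $A(v)=(A_{ij}(v))$ and $\sigma_j(\lambda)=\sum_{1\le i_1<\dots<i_j\le n}\lambda_{i_1}\cdots\lambda_{i_j}$ (with $\sigma_0=1$). Let $\Gamma_k=\{\lambda\in\mathbb R^n:\sigma_i(\lambda)\ge0,\ 1\le i\le k\}$, let $$\tilde\Phi^k(\Omega)=\{u\in C^2(\Omega):\ u>0,\ \lambda\{A(u)\}\in\Gamma_k \text{ in } \Omega\},$$ and let $\Phi^k(\Omega)$ be the set of all $u\in L^1_{loc}(\Omega)$ with $u>0$ (almost everywhere) for which there is a sequence in $\tilde\Phi^k(\Omega)$ converging to $u$ in $L^1_{loc}(\Omega)$. Write $C^2(\bar\Omega)$ for the functions that are $C^2$ in $\Omega$ and which, together with their derivatives of order at most two, extend continuously to $\bar\Omega$.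 Theorem. Let $u,v\in\Phi^k(\Omega)\cap C^2(\bar\Omega)$ satisfy $u\ge v$ in $\Omega$ and $u=v$ on $\partial\Omega$. Then for every real $\alpha\ge0$ both integrals below converge absolutely and $$\int_\Omega\sum_{l=0}^k b_l\,u^\alpha|\nabla u|^{2l}S_{k-l}(u)\,dx\ \le\ \int_\Omega\sum_{l=0}^k b_l\,v^\alpha|\nabla v|^{2l}S_{k-l}(v)\,dx,$$ where $$b_l=\big[(k+l)\alpha+kn+2kl\big]\,\frac{(\alpha+n+l-1)!}{2^l\,l!\,(\alpha+n)!}\ \ge 0,\qquad l=0,\dots,k,$$ with $x!=\Gamma(x+1)$ for real $x$ (here $\Gamma$ is the Gamma function). -/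

import Mathlib

open MeasureTheory Set Filter Topology

noncomputable section

namespace SigmaYamabe

/-- The elementary symmetric function `σ_k(λ)` of an unordered tuple of real numbers;
`σ_0 = 1`. -/
def sigma (k : ℕ) (lam : Multiset ℝ) : ℝ := lam.esymm k

/-- The (closed) Gårding cone `Γ_k = {λ : σ_i(λ) ≥ 0 for 1 ≤ i ≤ k}`, as a condition on
unordered tuples. -/
def gardingCone (k : ℕ) : Set (Multiset ℝ) :=
  {lam | ∀ i, 1 ≤ i → i ≤ k → 0 ≤ sigma i lam}

/-- The Hessian matrix `(v_{ij})` of `v` at `x`, formed with second order partial derivatives. -/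
def hessian {n : ℕ} (v : EuclideanSpace ℝ (Fin n) → ℝ) (x : EuclideanSpace ℝ (Fin n)) :
    Matrix (Fin n) (Fin n) ℝ :=
  Matrix.of fun i j =>
    fderiv ℝ (fun y => fderiv ℝ v y (EuclideanSpace.single i 1)) x (EuclideanSpace.single j 1)

/-- The conformal Schouten matrix `A_{ij}(v) = v v_{ij} - (1/2) |∇v|² δ_{ij}`. -/
def schouten {n : ℕ} (v : EuclideanSpace ℝ (Fin n) → ℝ) (x : EuclideanSpace ℝ (Fin n)) :
    Matrix (Fin n) (Fin n) ℝ :=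
  v x • hessian v x - ((1 / 2 : ℝ) * ‖gradient v x‖ ^ 2) • (1 : Matrix (Fin n) (Fin n) ℝ)

/-- The real eigenvalues of a matrix, listed with (algebraic) multiplicity. For a symmetric
`n × n` matrix this is the unordered `n`-tuple of all its eigenvalues. -/
def eigenvalues {n : ℕ} (A : Matrix (Fin n) (Fin n) ℝ) : Multiset ℝ := A.charpoly.roots

/-- The `σ_k`-Yamabe operator `S_k(v) = σ_k(λ{A_{ij}(v)})`. -/
def S {n : ℕ} (k : ℕ) (v : EuclideanSpace ℝ (Fin n) → ℝ) (x : EuclideanSpace ℝ (Fin n)) : ℝ :=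
  sigma k (eigenvalues (schouten v x))

/-- The class `Φ̃^k(Ω)`: positive `C²` functions on `Ω` with `λ{A_{ij}(u)} ∈ Γ_k` in `Ω`. -/
structure PhiTilde {n : ℕ} (k : ℕ) (Ω : Set (EuclideanSpace ℝ (Fin n)))
    (u : EuclideanSpace ℝ (Fin n) → ℝ) : Prop where
  contDiffOn : ContDiffOn ℝ 2 u Ω
  pos : ∀ x ∈ Ω, 0 < u x
  mem_cone : ∀ x ∈ Ω, eigenvalues (schouten u x) ∈ gardingCone k

/-- The class `Φ^k(Ω)`: positive functions in `L¹_loc(Ω)` that are limits in `L¹_loc(Ω)` of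
sequences in `Φ̃^k(Ω)`. As usual for elements of `L¹_loc`, positivity is meant almost
everywhere. -/
structure Phi {n : ℕ} (k : ℕ) (Ω : Set (EuclideanSpace ℝ (Fin n)))
    (u : EuclideanSpace ℝ (Fin n) → ℝ) : Prop where
  locallyIntegrableOn : LocallyIntegrableOn u Ω volume
  pos : ∀ᵐ x ∂(volume.restrict Ω), 0 < u x
  exists_seq : ∃ w : ℕ → EuclideanSpace ℝ (Fin n) → ℝ, (∀ m, PhiTilde k Ω (w m)) ∧
    ∀ K : Set (EuclideanSpace ℝ (Fin n)), IsCompact K → K ⊆ Ω →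
      Tendsto (fun m => eLpNorm (fun x => w m x - u x) 1 (volume.restrict K)) atTop (𝓝 0)

/-- The class `C²(Ω̄)` for an open set `Ω`: `u` is `C²` in `Ω`, and `u` together with its
derivatives of order one and two extend continuously to `Ω̄` (the values of `u` on `∂Ω` being
those of its continuous extension). -/
structure C2Closure {n : ℕ} (Ω : Set (EuclideanSpace ℝ (Fin n)))
    (u : EuclideanSpace ℝ (Fin n) → ℝ) : Prop where
  contDiffOn : ContDiffOn ℝ 2 u Ω
  continuousOn : ContinuousOn u (closure Ω)
  gradient_extends : ∃ g : EuclideanSpace ℝ (Fin n) → EuclideanSpace ℝ (Fin n),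
    ContinuousOn g (closure Ω) ∧ EqOn g (gradient u) Ω
  hessian_extends : ∃ H : EuclideanSpace ℝ (Fin n) → Matrix (Fin n) (Fin n) ℝ,
    ContinuousOn H (closure Ω) ∧ EqOn H (hessian u) Ω

/-- The coefficients
`b_l = [(k + l) α + k n + 2 k l] (α + n + l - 1)! / (2^l l! (α + n)!)`,
where `x! = Γ(x + 1)` for real `x`. -/
def b (n k : ℕ) (α : ℝ) (l : ℕ) : ℝ :=
  (((k : ℝ) + l) * α + k * n + 2 * k * l) *
    (Real.Gamma (α + n + l) / (2 ^ l * (l.factorial : ℝ) * Real.Gamma (α + n + 1)))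

/-- The integrand `ψ(w) = ∑_{l = 0}^k b_l w^α |∇w|^{2l} S_{k-l}(w)`. -/
def psi {n : ℕ} (k : ℕ) (α : ℝ) (w : EuclideanSpace ℝ (Fin n) → ℝ)
    (x : EuclideanSpace ℝ (Fin n)) : ℝ :=
  ∑ l ∈ Finset.range (k + 1),
    b n k α l * w x ^ α * ‖gradient w x‖ ^ (2 * l) * S (k - l) w x

end SigmaYamabe

end

/-!
For `α ≥ 0` write `Ψ(w, ∇w, D²w)` for the integrand. Two properties of `Ψ` give the theorem.

*It is a divergence.* Expanding `S_{k-l}` in the functions `σ_i(D²w)` (`Psi_eq_sum`) brings the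
coefficients `b_l` into a form in which `Ψ` is the sum of the divergences of the fluxes
`d_m w ^ (α + m + 1) |∇w| ^ (2 (k - 1 - m)) T_m(D²w) ∇w`, where `T_m` are the Newton transformations
(`jetPsi_eq_sum`). That such a flux contributes nothing to the integral for functions of compact
support is derived without third derivatives: for a compactly supported `C¹` field `H` the map
`id + s H` is a bijection of a compact set onto itself for small `s`, so `∫ det (1 + s DH)` is
independent of `s` and `∫ σ_j(DH) = 0` (`integral_sig_jac`); the divergence identity is the term
of first order in `s` for `H = (1 + s f) ∇w`. Hence `∫ Ψ` does not change under perturbations of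
compact support that keep the function nonnegative (`integral_jet_sub_jet`).

*It is elliptic on admissible jets.* The condition `w D²w - |∇w|² / 2 ∈ Γ_k` for `w > 0` is
equivalent to the family of constraints `D²w - (ξ · ∇w - |ξ|² w / 2) 1 ∈ Γ_k`, `ξ ∈ ℝⁿ`, which are
linear in the 2-jet of `w` (`JetAdm`). As `Γ_k` is a closed convex cone, the constraints amount to
linear differential inequalities with constant coefficients. Therefore they pass to limits in
`L¹_loc` (`Phi.jetAdm`), and admissible jets form a convex cone (`JetAdm.combine`). The convexity
of `Γ_k` is proved for vectors by the induction of Marcus and Lopes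
(`add_mem_posCone_and_div_es_le`), and for matrices by Birkhoff's theorem on doubly stochastic
matrices (`add_mem_matCone`). On admissible jets, adding a matrix `z ⊗ z` to `D²w` does not
decrease `Ψ` (`JetAdm.rankOneCoeff_nonneg`).

To compare `u ≥ v`, let `w_N = v + ρ(N (u - v)) / N` with a smooth convex function `ρ` that
vanishes on `(-∞, 1]` and has slope one on `[2, ∞)`. Since `u = v` on the boundary, `w_N = v` near
the boundary, and `∫ Ψ(w_N) = ∫ Ψ(v)`. The derivatives of `w_N` are convex combinations of those
of `u` and `v`, plus a nonnegative multiple of `z ⊗ z` with `z = ∇u - ∇v` in the Hessian. The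
rank-one part may be dropped at the cost of an error which is bounded and tends to zero pointwise
(`JetAdm.jetPsi_sub_le`, `exists_interpJet_le`). What is left converges to `Ψ(u)` almost
everywhere, because the 2-jets of `u` and `v` agree almost everywhere on `{u = v}` (`ae_jet_eq`).
Dominated convergence gives `∫ Ψ(u) ≤ ∫ Ψ(v)`.
-/

noncomputable section

namespace SigmaYamabe

section Algebra

open Polynomial Matrix

variable {n : ℕ}

/-! ### Elementary symmetric functions of matrices and Newton transformations -/

/-- The polynomial `det (1 + X A)`, whose coefficients are the elementary symmetric functions of
the eigenvalues of `A`. -/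
def pencil (A : Matrix (Fin n) (Fin n) ℝ) : ℝ[X] := (1 + (X : ℝ[X]) • A.map C).det

/-- The `j`-th elementary symmetric function of the eigenvalues of `A`, encoded as the coefficient
of `X ^ j` in `det (1 + X A)`. This is a polynomial in the entries of an arbitrary matrix. -/
def sig (j : ℕ) (A : Matrix (Fin n) (Fin n) ℝ) : ℝ := (pencil A).coeff j

theorem eval_pencil (A : Matrix (Fin n) (Fin n) ℝ) (s : ℝ) :
    (pencil A).eval s = (1 + s • A).det := by
  rw [pencil, ← coe_evalRingHom, RingHom.map_det]
  congr 1
  ext i j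
  by_cases h : i = j <;> simp [h] <;> ring

theorem natDegree_pencil_le (A : Matrix (Fin n) (Fin n) ℝ) : (pencil A).natDegree ≤ n := by
  have := natDegree_det_X_add_C_le A (1 : Matrix (Fin n) (Fin n) ℝ)
  rw [add_comm] at this
  simpa [pencil] using this

/-- Coefficients of polynomials of bounded degree are fixed linear combinations of the values at
fixed nodes. -/
theorem exists_coeff_eq_sum_eval (N j : ℕ) {s : ℕ → ℝ} (hs : Function.Injective s) :
    ∃ c : ℕ → ℝ, ∀ p : ℝ[X], p.natDegree ≤ N →
      p.coeff j = ∑ i ∈ Finset.range (N + 1), c i * p.eval (s i) := by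
  refine ⟨fun i => (Lagrange.basis (Finset.range (N + 1)) s i).coeff j, fun p hp => ?_⟩
  have hd : p.degree < (Finset.range (N + 1)).card := by
    rw [Finset.card_range]
    exact lt_of_le_of_lt (degree_le_of_natDegree_le hp) (by exact_mod_cast Nat.lt_succ_self N)
  conv_lhs => rw [Lagrange.eq_interpolate hs.injOn hd]
  rw [Lagrange.interpolate_apply, finsetSum_coeff]
  exact Finset.sum_congr rfl fun i _ => by rw [coeff_C_mul, mul_comm]

theorem exists_sig_eq_sum_det (j : ℕ) {s : ℕ → ℝ} (hs : Function.Injective s) :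
    ∃ c : ℕ → ℝ, ∀ A : Matrix (Fin n) (Fin n) ℝ,
      sig j A = ∑ i ∈ Finset.range (n + 1), c i * (1 + s i • A).det := by
  obtain ⟨c, hc⟩ := exists_coeff_eq_sum_eval n j hs
  exact ⟨c, fun A => by simp [sig, hc _ (natDegree_pencil_le A), eval_pencil]⟩

theorem continuous_sig (j : ℕ) :
    Continuous (sig j : Matrix (Fin n) (Fin n) ℝ → ℝ) := by
  obtain ⟨c, hc⟩ := exists_sig_eq_sum_det (n := n) j (Nat.cast_injective (R := ℝ))
  rw [show (sig j : Matrix (Fin n) (Fin n) ℝ → ℝ) = _ from funext hc]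
  refine continuous_finsetSum _ fun i _ => continuous_const.mul ?_
  exact Continuous.matrix_det (by fun_prop)

@[simp] theorem sig_zero (A : Matrix (Fin n) (Fin n) ℝ) : sig 0 A = 1 := by
  rw [sig, coeff_zero_eq_eval_zero, eval_pencil]; simp

theorem pencil_ne_zero (A : Matrix (Fin n) (Fin n) ℝ) : pencil A ≠ 0 := by
  intro h
  have := sig_zero A
  simp [sig, h] at this

theorem sig_smul (j : ℕ) (c : ℝ) (A : Matrix (Fin n) (Fin n) ℝ) :
    sig j (c • A) = c ^ j * sig j A := by
  have : pencil (c • A) = (pencil A).comp (C c * X) := by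
    refine Polynomial.funext fun s => ?_
    rw [eval_comp, eval_pencil, eval_pencil, smul_smul, eval_mul, eval_C, eval_X, mul_comm s]
  rw [sig, this, comp_C_mul_X_coeff, mul_comm, sig]

theorem sig_zero_matrix {j : ℕ} (hj : j ≠ 0) : sig j (0 : Matrix (Fin n) (Fin n) ℝ) = 0 := by
  have := sig_smul j 0 (0 : Matrix (Fin n) (Fin n) ℝ)
  simpa [hj] using this

theorem sig_conj (j : ℕ) {U V : Matrix (Fin n) (Fin n) ℝ} (h : U * V = 1)
    (A : Matrix (Fin n) (Fin n) ℝ) : sig j (U * A * V) = sig j A := by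
  have : pencil (U * A * V) = pencil A := by
    refine Polynomial.funext fun s => ?_
    rw [eval_pencil, eval_pencil]
    have e : 1 + s • (U * A * V) = U * (1 + s • A) * V := by
      rw [mul_add, mul_one, add_mul, h, Matrix.mul_smul, Matrix.smul_mul]
    have h2 : U.det * V.det = 1 := by rw [← det_mul, h, det_one]
    rw [e, det_mul, det_mul]
    linear_combination (1 + s • A).det * h2
  rw [sig, this, sig]

/-- `(b, adj (1 + X A) a)`, the polynomial governing rank-one perturbations of `det (1 + X A)`. -/
def tauPoly (A : Matrix (Fin n) (Fin n) ℝ) (a b : Fin n → ℝ) : ℝ[X] :=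
  (fun i => C (b i)) ⬝ᵥ ((1 + (X : ℝ[X]) • A.map C).adjugate *ᵥ fun i => C (a i))

/-- The bilinear form `(b, T_m(A) a)` of the `m`-th Newton transformation `T_m(A)`, the
coefficient of `X ^ m` in `adj (1 + X A)`. -/
def tau (m : ℕ) (A : Matrix (Fin n) (Fin n) ℝ) (a b : Fin n → ℝ) : ℝ := (tauPoly A a b).coeff m

theorem eval_tauPoly (A : Matrix (Fin n) (Fin n) ℝ) (a b : Fin n → ℝ) (s : ℝ) :
    (tauPoly A a b).eval s = b ⬝ᵥ ((1 + s • A).adjugate *ᵥ a) := by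
  have h : (evalRingHom s).mapMatrix ((1 + (X : ℝ[X]) • A.map C).adjugate) =
      (1 + s • A).adjugate := by
    rw [RingHom.map_adjugate]
    congr 1
    ext i j
    by_cases h : i = j <;> simp [h] <;> ring
  rw [← h]
  simp [tauPoly, dotProduct, mulVec, eval_finsetSum]

theorem det_add_vecMulVec {M : Matrix (Fin n) (Fin n) ℝ} (hM : M.det ≠ 0) (a b : Fin n → ℝ) :
    (M + vecMulVec a b).det = M.det + b ⬝ᵥ (M.adjugate *ᵥ a) := by
  have h := det_add_replicateCol_mul_replicateRow (ι := Unit) (isUnit_iff_ne_zero.mpr hM) a b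
  rw [← vecMulVec_eq] at h
  rw [h, det_unique (n := Unit), Matrix.add_apply, one_apply_eq, mul_add, mul_one, Matrix.inv_def,
    Ring.inverse_eq_inv']
  congr 1
  rw [Matrix.mul_assoc]
  rw [smul_mul, Matrix.mul_smul, Matrix.smul_apply, smul_eq_mul, mul_inv_cancel_left₀ hM]
  simp only [Matrix.mul_apply, replicateRow_apply, replicateCol_apply, dotProduct, mulVec]

/-- The matrix determinant lemma for `1 + X A`. Both sides are multiplied by `pencil A`, so that it
is enough to compare values at points where `1 + s A` is invertible. -/
theorem pencil_add_vecMulVec (A : Matrix (Fin n) (Fin n) ℝ) (c : ℝ) (a b : Fin n → ℝ) :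
    pencil (A + c • vecMulVec a b) = pencil A + C c * X * tauPoly A a b := by
  refine mul_left_cancel₀ (pencil_ne_zero A) (Polynomial.funext fun s => ?_)
  rw [eval_mul, eval_mul]
  by_cases h : (pencil A).eval s = 0
  · rw [h, zero_mul, zero_mul]
  congr 1
  rw [eval_pencil] at h ⊢
  have e : 1 + s • (A + c • vecMulVec a b) = (1 + s • A) + vecMulVec ((s * c) • a) b := by
    rw [smul_add, smul_smul, smul_vecMulVec, add_assoc]
  rw [e, det_add_vecMulVec h]
  simp [eval_pencil, eval_tauPoly, mulVec_smul, mul_comm s c]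

/-- Elementary symmetric functions are affine along rank-one perturbations. -/
theorem sig_add_vecMulVec (m : ℕ) (A : Matrix (Fin n) (Fin n) ℝ) (c : ℝ) (a b : Fin n → ℝ) :
    sig (m + 1) (A + c • vecMulVec a b) = sig (m + 1) A + c * tau m A a b := by
  rw [sig, pencil_add_vecMulVec, coeff_add, mul_assoc, coeff_C_mul, coeff_X_mul, sig, tau]

theorem tau_eq_sub (m : ℕ) (A : Matrix (Fin n) (Fin n) ℝ) (a b : Fin n → ℝ) :
    tau m A a b = sig (m + 1) (A + vecMulVec a b) - sig (m + 1) A := by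
  have := sig_add_vecMulVec m A 1 a b
  rw [one_smul] at this
  rw [this]; ring

theorem tau_add_right (m : ℕ) (A : Matrix (Fin n) (Fin n) ℝ) (a b b' : Fin n → ℝ) :
    tau m A a (b + b') = tau m A a b + tau m A a b' := by
  have : tauPoly A a (b + b') = tauPoly A a b + tauPoly A a b' :=
    Polynomial.funext fun s => by simp [eval_tauPoly, add_dotProduct]
  rw [tau, this, coeff_add, tau, tau]

theorem tau_smul_right (m : ℕ) (A : Matrix (Fin n) (Fin n) ℝ) (c : ℝ) (a b : Fin n → ℝ) :
    tau m A a (c • b) = c * tau m A a b := by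
  have : tauPoly A a (c • b) = C c * tauPoly A a b :=
    Polynomial.funext fun s => by simp [eval_tauPoly, smul_dotProduct]
  rw [tau, this, coeff_C_mul, tau]

/-- The identity `adj (1 + X A) (1 + X A) = det (1 + X A)` as a relation of bilinear forms. -/
theorem tauPoly_add_X_mul_tauPoly_mulVec {A : Matrix (Fin n) (Fin n) ℝ} (hA : Aᵀ = A)
    (a b : Fin n → ℝ) :
    tauPoly A a b + X * tauPoly A a (A *ᵥ b) = C (a ⬝ᵥ b) * pencil A := by
  refine Polynomial.funext fun s => ?_
  simp only [eval_add, eval_mul, eval_X, eval_C, eval_tauPoly, eval_pencil]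
  have h1 : (1 + s • A) *ᵥ ((1 + s • A).adjugate *ᵥ a) = (1 + s • A).det • a := by
    rw [mulVec_mulVec, mul_adjugate, smul_mulVec, one_mulVec]
  have h2 : b ⬝ᵥ ((1 + s • A) *ᵥ ((1 + s • A).adjugate *ᵥ a)) =
      b ⬝ᵥ ((1 + s • A).adjugate *ᵥ a) + s * ((A *ᵥ b) ⬝ᵥ ((1 + s • A).adjugate *ᵥ a)) := by
    rw [add_mulVec, one_mulVec, dotProduct_add, smul_mulVec, dotProduct_smul, smul_eq_mul,
      dotProduct_mulVec b A, ← mulVec_transpose, hA]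
  rw [← h2, h1, dotProduct_smul, smul_eq_mul, dotProduct_comm]
  ring

theorem tau_zero {A : Matrix (Fin n) (Fin n) ℝ} (hA : Aᵀ = A) (a b : Fin n → ℝ) :
    tau 0 A a b = a ⬝ᵥ b := by
  have := congrArg (fun p => coeff p 0) (tauPoly_add_X_mul_tauPoly_mulVec hA a b)
  have h0 : (pencil A).coeff 0 = 1 := sig_zero A
  simpa [tau, h0] using this

/-- The recursion `T_{m+1}(A) = σ_{m+1}(A) - T_m(A) A` for Newton transformations. -/
theorem tau_succ {A : Matrix (Fin n) (Fin n) ℝ} (hA : Aᵀ = A) (m : ℕ) (a b : Fin n → ℝ) :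
    tau (m + 1) A a b + tau m A a (A *ᵥ b) = (a ⬝ᵥ b) * sig (m + 1) A := by
  have := congrArg (fun p => coeff p (m + 1)) (tauPoly_add_X_mul_tauPoly_mulVec hA a b)
  simpa [tau, sig, coeff_X_mul] using this

theorem continuous_tau (m : ℕ) : Continuous fun x : Matrix (Fin n) (Fin n) ℝ × (Fin n → ℝ) ×
    (Fin n → ℝ) => tau m x.1 x.2.1 x.2.2 := by
  simp_rw [tau_eq_sub]
  refine ((continuous_sig _).comp ?_).sub ((continuous_sig _).comp continuous_fst)
  exact continuous_fst.add (Continuous.matrix_vecMulVec (by fun_prop) (by fun_prop))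

theorem pencil_diagonal (d : Fin n → ℝ) : pencil (diagonal d) = ∏ i, (1 + C (d i) * X) := by
  refine Polynomial.funext fun s => ?_
  rw [eval_pencil, eval_prod]
  have : 1 + s • diagonal d = diagonal fun i => 1 + s * d i := by
    ext i j; by_cases h : i = j <;> simp [h]
  rw [this, det_diagonal]
  simp only [eval_add, eval_one, eval_mul, eval_C, eval_X, mul_comm]

theorem prod_one_add_C_mul_X_coeff {ι : Type*} (s : Finset ι) (d : ι → ℝ) (j : ℕ) :
    (∏ i ∈ s, (1 + C (d i) * X)).coeff j = ∑ t ∈ s.powersetCard j, ∏ i ∈ t, d i := by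
  classical
  rw [Finset.prod_one_add, finsetSum_coeff, Finset.powersetCard_eq_filter, Finset.sum_filter]
  refine Finset.sum_congr rfl fun t _ => ?_
  rw [Finset.prod_mul_distrib, Finset.prod_const, ← map_prod, coeff_C_mul, coeff_X_pow]
  simp [eq_comm]

theorem sig_diagonal (j : ℕ) (d : Fin n → ℝ) :
    sig j (diagonal d) = ∑ t ∈ Finset.univ.powersetCard j, ∏ i ∈ t, d i := by
  rw [sig, pencil_diagonal, prod_one_add_C_mul_X_coeff]

theorem exists_orthogonal_diagonal {A : Matrix (Fin n) (Fin n) ℝ} (hA : A.IsHermitian) :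
    ∃ U : Matrix (Fin n) (Fin n) ℝ, U * Uᵀ = 1 ∧ Uᵀ * U = 1 ∧
      A = U * diagonal hA.eigenvalues * Uᵀ := by
  refine ⟨hA.eigenvectorUnitary, ?_, ?_, ?_⟩
  · exact Unitary.coe_mul_star_self hA.eigenvectorUnitary
  · exact Unitary.coe_star_mul_self hA.eigenvectorUnitary
  · conv_lhs => rw [hA.spectral_theorem, Unitary.conjStarAlgAut_apply]
    rfl

theorem sig_eq_sum_eigenvalues (j : ℕ) {A : Matrix (Fin n) (Fin n) ℝ} (hA : A.IsHermitian) :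
    sig j A = ∑ t ∈ Finset.univ.powersetCard j, ∏ i ∈ t, hA.eigenvalues i := by
  obtain ⟨U, h1, -, h2⟩ := exists_orthogonal_diagonal hA
  conv_lhs => rw [h2, sig_conj j h1, sig_diagonal]

/-- On symmetric matrices `sig` is the elementary symmetric function of the roots of the
characteristic polynomial. -/
theorem sigma_eigenvalues (j : ℕ) {A : Matrix (Fin n) (Fin n) ℝ} (hA : A.IsHermitian) :
    sigma j (eigenvalues A) = sig j A := by
  rw [sigma, eigenvalues, hA.roots_charpoly_eq_eigenvalues, Finset.esymm_map_val,
    sig_eq_sum_eigenvalues j hA]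
  rfl

theorem sig_one_nonneg (j : ℕ) : 0 ≤ sig j (1 : Matrix (Fin n) (Fin n) ℝ) := by
  rw [← diagonal_one, sig_diagonal]
  exact Finset.sum_nonneg fun t _ => Finset.prod_nonneg fun i _ => zero_le_one

/-! ### Convexity of the Gårding cone -/

theorem splits_derivative {p : ℝ[X]} (hp : p.Splits) : (derivative p).Splits := by
  rw [splits_iff_card_roots]
  refine le_antisymm (card_roots' _) ?_
  have h1 := card_roots_le_derivative p
  have h2 := natDegree_derivative_le p
  have h3 := hp.natDegree_eq_card_roots
  omega

/-- Laguerre's inequality for real-rooted polynomials. -/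
theorem mul_eval_derivative_le_sq {p : ℝ[X]} (hp : p.Splits) (x : ℝ) :
    p.eval x * (derivative (derivative p)).eval x ≤ (derivative p).eval x ^ 2 := by
  rw [hp.eq_prod_roots]
  generalize p.roots = r
  generalize p.leadingCoeff = c
  induction r using Multiset.induction_on with
  | empty => simp
  | cons a r ih =>
    have e : C c * (Multiset.map (fun z => X - C z) (a ::ₘ r)).prod =
        (X - C a) * (C c * (Multiset.map (fun z => X - C z) r).prod) := by
      rw [Multiset.map_cons, Multiset.prod_cons]; ring
    rw [e]
    set g := C c * (Multiset.map (fun z => X - C z) r).prod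
    simp only [derivative_mul, derivative_sub, derivative_X, derivative_C, sub_zero, one_mul,
      derivative_add, eval_add, eval_mul, eval_sub, eval_X, eval_C]
    nlinarith [mul_nonneg (sq_nonneg (x - a)) (sub_nonneg.mpr ih), sq_nonneg (eval x g)]

/-- The `j`-th elementary symmetric function of `d i`, `i ∈ s`. -/
def es {ι : Type*} (s : Finset ι) (j : ℕ) (d : ι → ℝ) : ℝ :=
  (∏ i ∈ s, (1 + C (d i) * X)).coeff j

section es

variable {ι : Type*} (s : Finset ι) (d : ι → ℝ)

@[simp] theorem es_zero : es s 0 d = 1 := by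
  simp [es, coeff_zero_eq_eval_zero, eval_prod]

theorem es_succ_erase [DecidableEq ι] {s : Finset ι} {i : ι} (hi : i ∈ s) (j : ℕ) :
    es s (j + 1) d = es (s.erase i) (j + 1) d + d i * es (s.erase i) j d := by
  rw [es, ← Finset.mul_prod_erase s _ hi, add_mul, one_mul, coeff_add, mul_assoc, coeff_C_mul,
    coeff_X_mul]
  rfl

theorem sum_mul_es_erase [DecidableEq ι] (j : ℕ) :
    ∑ i ∈ s, d i * es (s.erase i) j d = (j + 1) * es s (j + 1) d := by
  have h := congrArg (fun p => coeff p j)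
    (derivative_prod_finset (s := s) (f := fun i => 1 + C (d i) * X))
  simp only [coeff_derivative, finsetSum_coeff] at h
  rw [es, mul_comm _ (coeff _ _), h]
  refine Finset.sum_congr rfl fun i _ => ?_
  rw [show derivative (1 + C (d i) * X) = C (d i) by simp, coeff_mul_C, mul_comm, es]

theorem es_smul (c : ℝ) (j : ℕ) : es s j (c • d) = c ^ j * es s j d := by
  have : ∏ i ∈ s, (1 + C ((c • d) i) * X) = (∏ i ∈ s, (1 + C (d i) * X)).comp (C c * X) := by
    rw [prod_comp]
    exact Finset.prod_congr rfl fun i _ => by simp; ring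
  rw [es, this, comp_C_mul_X_coeff, mul_comm, es]

theorem es_comp_perm [Fintype ι] (σ : Equiv.Perm ι) (j : ℕ) :
    es Finset.univ j (d ∘ σ) = es Finset.univ j d := by
  rw [es, es, ← Equiv.prod_comp σ (fun i => 1 + C (d i) * X)]
  rfl

theorem continuous_es (j : ℕ) : Continuous fun d : ι → ℝ => es s j d := by
  simp_rw [es, prod_one_add_C_mul_X_coeff]
  fun_prop

/-- A weak form of Newton's inequality. -/
theorem es_mul_es_le_sq (j : ℕ) : es s j d * es s (j + 2) d ≤ es s (j + 1) d ^ 2 := by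
  set p := ∏ i ∈ s, (1 + C (d i) * X) with hp
  have hs : (derivative^[j] p).Splits := by
    have h0 : p.Splits := Splits.prod fun i _ => Splits.of_natDegree_le_one (by compute_degree)
    clear_value p
    clear hp
    induction j with
    | zero => exact h0
    | succ j ih => rw [Function.iterate_succ_apply']; exact splits_derivative ih
  have h := mul_eval_derivative_le_sq hs 0
  rw [← Function.iterate_succ_apply' derivative, ← Function.iterate_succ_apply' derivative] at h
  simp only [← coeff_zero_eq_eval_zero, coeff_iterate_derivative, zero_add,
    Nat.descFactorial_self, nsmul_eq_mul] at h
  change (j.factorial * es s j d) * ((j + 2).factorial * es s (j + 2) d) ≤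
    ((j + 1).factorial * es s (j + 1) d) ^ 2 at h
  rw [Nat.factorial_succ (j + 1), Nat.factorial_succ j] at h
  push_cast at h
  by_contra! hlt
  have hf : (0 : ℝ) < j.factorial := by exact_mod_cast j.factorial_pos
  have hq : 0 < es s j d * es s (j + 2) d := (sq_nonneg _).trans_lt hlt
  have h2 : (j + 2) * (es s j d * es s (j + 2) d) ≤ (j + 1) * es s (j + 1) d ^ 2 := by
    refine le_of_mul_le_mul_left (a := (j.factorial : ℝ) ^ 2 * (j + 1)) ?_ (by positivity)
    linarith
  have hj : (0 : ℝ) ≤ j := j.cast_nonneg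
  nlinarith

/-- The open Gårding cone for vectors indexed by `s`. -/
def posCone (s : Finset ι) (k : ℕ) : Set (ι → ℝ) := {d | ∀ j ≤ k, 0 < es s j d}

variable {s d}

/-- Omitting one variable maps the `(k + 1)`-st open cone into the `k`-th one: if `σ_{j+1}` were
nonpositive without the variable, Newton's inequality would make `σ_{j+2}` nonpositive. -/
theorem erase_mem_posCone [DecidableEq ι] {k : ℕ} (h : d ∈ posCone s (k + 1)) {i : ι}
    (hi : i ∈ s) : d ∈ posCone (s.erase i) k := by
  intro j
  induction j with
  | zero => simp
  | succ j ih =>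
    intro hj
    by_contra! ha
    have h0 := ih (by omega)
    have h1 := h (j + 1) (by omega)
    have h2 := h (j + 2) (by omega)
    rw [es_succ_erase d hi] at h1 h2
    have hN := es_mul_es_le_sq (s.erase i) d j
    set a := es (s.erase i) (j + 1) d
    set e := es (s.erase i) j d
    have h3 : e * (-(d i * a)) < e * es (s.erase i) (j + 2) d :=
      mul_lt_mul_of_pos_left (by linarith) h0
    nlinarith

/-- A recursion for `σ_{k+2} / σ_{k+1}`, in terms of the quotients `σ_{k+1} / σ_k` with one variable
omitted. Each summand is a concave function of `d i` and of that quotient, and nondecreasing in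
the latter. -/
theorem div_es_succ [DecidableEq ι] {k : ℕ} (h : d ∈ posCone s (k + 1)) :
    (k + 2) * (es s (k + 2) d / es s (k + 1) d) =
      ∑ i ∈ s, (d i - d i ^ 2 / (d i + es (s.erase i) (k + 1) d / es (s.erase i) k d)) := by
  have h1 := sum_mul_es_erase s d (k + 1)
  push_cast at h1
  rw [← mul_div_assoc, show (k : ℝ) + 2 = k + 1 + 1 by ring, ← h1, Finset.sum_div]
  refine Finset.sum_congr rfl fun i hi => ?_
  have hp := h (k + 1) le_rfl
  have he := es_succ_erase d hi k
  have h0 := erase_mem_posCone h hi k le_rfl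
  rw [he] at hp ⊢
  set a := es (s.erase i) (k + 1) d
  set e := es (s.erase i) k d
  have : d i + a / e = (a + d i * e) / e := by field_simp; ring
  rw [this]
  have hne := hp.ne'
  have h0e := h0.ne'
  field_simp
  ring

theorem div_es_pos [DecidableEq ι] {k : ℕ} (h : d ∈ posCone s (k + 1)) {i : ι} (hi : i ∈ s) :
    0 < d i + es (s.erase i) (k + 1) d / es (s.erase i) k d := by
  have hp := h (k + 1) le_rfl
  have h0 := erase_mem_posCone h hi k le_rfl
  rw [es_succ_erase d hi] at hp
  have : d i + es (s.erase i) (k + 1) d / es (s.erase i) k d =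
      (es (s.erase i) (k + 1) d + d i * es (s.erase i) k d) / es (s.erase i) k d := by
    field_simp; ring
  rw [this]; positivity

theorem add_sq_div_le {a b y z w : ℝ} (hy : 0 < y) (hz : 0 < z) (hw : y + z ≤ w) :
    (a + b) ^ 2 / w ≤ a ^ 2 / y + b ^ 2 / z := by
  have h1 : (a + b) ^ 2 / w ≤ (a + b) ^ 2 / (y + z) :=
    div_le_div_of_nonneg_left (sq_nonneg _) (by positivity) hw
  refine h1.trans ?_
  rw [div_add_div _ _ hy.ne' hz.ne', div_le_div_iff₀ (by positivity) (by positivity)]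
  nlinarith [sq_nonneg (a * z - b * y), mul_pos hy hz]

/-- The open Gårding cone is closed under addition, and `σ_{k+1} / σ_k` is superadditive on it.
The two facts are proved together by the induction of Marcus and Lopes. -/
theorem add_mem_posCone_and_div_es_le (k : ℕ) : ∀ (s : Finset ι) {d e : ι → ℝ},
    d ∈ posCone s k → e ∈ posCone s k → d + e ∈ posCone s k ∧
      es s (k + 1) d / es s k d + es s (k + 1) e / es s k e ≤
        es s (k + 1) (d + e) / es s k (d + e) := by
  classical
  induction k with
  | zero =>
    intro s d e _ _
    refine ⟨fun j hj => ?_, ?_⟩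
    · rw [Nat.le_zero.mp hj, es_zero]; exact one_pos
    · have h (d : ι → ℝ) : es s 1 d = ∑ i ∈ s, d i := by
        have := sum_mul_es_erase s d 0
        simpa using this.symm
      simp [h, Finset.sum_add_distrib]
  | succ k ih =>
    intro s d e hd he
    obtain ⟨hm, hq⟩ := ih s (fun j hj => hd j (by omega)) (fun j hj => he j (by omega))
    have hde : d + e ∈ posCone s (k + 1) := by
      intro j hj
      rcases Nat.lt_or_eq_of_le hj with hj | rfl
      · exact hm j (by omega)
      · have h1 : 0 < es s (k + 1) d / es s k d := div_pos (hd _ le_rfl) (hd _ (by omega))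
        have h2 : 0 < es s (k + 1) e / es s k e := div_pos (he _ le_rfl) (he _ (by omega))
        have h3 : 0 < es s (k + 1) (d + e) / es s k (d + e) := by linarith
        exact (div_pos_iff_of_pos_right (hm k le_rfl)).mp h3
    refine ⟨hde, ?_⟩
    have hk : (0 : ℝ) < k + 2 := by positivity
    refine le_of_mul_le_mul_left ?_ hk
    rw [mul_add, div_es_succ hd, div_es_succ he, div_es_succ hde, ← Finset.sum_add_distrib]
    refine Finset.sum_le_sum fun i hi => ?_
    have h1 := (ih (s.erase i) (erase_mem_posCone hd hi) (erase_mem_posCone he hi)).2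
    have h2 := add_sq_div_le (a := d i) (b := e i) (div_es_pos hd hi) (div_es_pos he hi)
      (w := (d + e) i + es (s.erase i) (k + 1) (d + e) / es (s.erase i) k (d + e))
      (by rw [Pi.add_apply]; linarith)
    simp only [Pi.add_apply] at h2 ⊢
    linarith

/-- The closed Gårding cone for vectors indexed by `s`. -/
def nonnegCone (s : Finset ι) (k : ℕ) : Set (ι → ℝ) := {d | ∀ j ≤ k, 0 ≤ es s j d}

theorem coeff_one_add_C_mul_X_pow (c : ℝ) (m j : ℕ) :
    ((1 + C c * X : ℝ[X]) ^ m).coeff j = m.choose j * c ^ j := by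
  have : (1 + C c * X : ℝ[X]) ^ m = ((1 + X) ^ m).comp (C c * X) := by simp
  rw [this, comp_C_mul_X_coeff, coeff_one_add_X_pow]

theorem es_add_const (c : ℝ) (k : ℕ) : es s k (fun i => d i + c) =
    ∑ j ∈ Finset.range (s.card + 1),
      es s j d * (X ^ j * (1 + C c * X) ^ (s.card - j) : ℝ[X]).coeff k := by
  classical
  have h : ∏ i ∈ s, (1 + C (d i + c) * X) = ∑ t ∈ s.powerset,
      C (∏ i ∈ t, d i) * (X ^ t.card * (1 + C c * X) ^ (s.card - t.card)) := by
    rw [Finset.prod_congr rfl (g := fun i => C (d i) * X + (1 + C c * X))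
      (fun i _ => by rw [C_add]; ring), Finset.prod_add]
    refine Finset.sum_congr rfl fun t ht => ?_
    rw [Finset.prod_mul_distrib, Finset.prod_const, Finset.prod_const, map_prod,
      Finset.card_sdiff_of_subset (Finset.mem_powerset.mp ht), mul_assoc]
  rw [es, h, finsetSum_coeff, Finset.sum_powerset]
  refine Finset.sum_congr rfl fun j _ => ?_
  rw [es, prod_one_add_C_mul_X_coeff, Finset.sum_mul]
  refine Finset.sum_congr rfl fun t ht => ?_
  rw [coeff_C_mul, (Finset.mem_powersetCard.mp ht).2]

/-- Translation along `(1, …, 1)` moves the closed cone into the open one. -/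
theorem add_const_mem_posCone {k : ℕ} (hk : k ≤ s.card) (h : d ∈ nonnegCone s k) {c : ℝ}
    (hc : 0 < c) : (fun i => d i + c) ∈ posCone s k := by
  intro m hm
  rw [es_add_const, Finset.sum_range_succ']
  refine add_pos_of_nonneg_of_pos (Finset.sum_nonneg fun j _ => ?_) ?_
  · rw [coeff_X_pow_mul']
    split_ifs with hj
    · rw [coeff_one_add_C_mul_X_pow]
      exact mul_nonneg (h _ (hj.trans hm)) (by positivity)
    · simp
  · rw [es_zero, pow_zero, one_mul, one_mul, coeff_one_add_C_mul_X_pow, Nat.sub_zero]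
    have : 0 < s.card.choose m := Nat.choose_pos (hm.trans hk)
    positivity

theorem add_mem_nonnegCone {k : ℕ} (hk : k ≤ s.card) {e : ι → ℝ} (hd : d ∈ nonnegCone s k)
    (he : e ∈ nonnegCone s k) : d + e ∈ nonnegCone s k := by
  intro j hj
  have hcont : Continuous fun c : ℝ => es s j ((fun i => d i + c) + fun i => e i + c) :=
    (continuous_es s j).comp (by fun_prop)
  have hlim : Tendsto (fun c : ℝ => es s j ((fun i => d i + c) + fun i => e i + c)) (𝓝[>] 0)
      (𝓝 (es s j (d + e))) := by
    have := (hcont.tendsto 0).mono_left (nhdsWithin_le_nhds (s := Ioi 0))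
    simpa using this
  refine ge_of_tendsto hlim (eventually_nhdsWithin_of_forall fun c hc => ?_)
  exact ((add_mem_posCone_and_div_es_le k s (add_const_mem_posCone hk hd hc)
    (add_const_mem_posCone hk he hc)).1 j hj).le

theorem smul_mem_nonnegCone {k : ℕ} (hd : d ∈ nonnegCone s k) {c : ℝ} (hc : 0 ≤ c) :
    c • d ∈ nonnegCone s k := fun j hj => by
  rw [es_smul]; exact mul_nonneg (pow_nonneg hc _) (hd j hj)

theorem zero_mem_nonnegCone (k : ℕ) : (0 : ι → ℝ) ∈ nonnegCone s k := fun j _ => by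
  rw [show (0 : ι → ℝ) = (0 : ℝ) • (0 : ι → ℝ) by simp, es_smul]
  rcases Nat.eq_zero_or_pos j with rfl | hj
  · simp
  · simp [hj.ne']

theorem sum_mem_nonnegCone {k : ℕ} (hk : k ≤ s.card) {κ : Type*} (t : Finset κ)
    {f : κ → ι → ℝ} (h : ∀ a ∈ t, f a ∈ nonnegCone s k) : ∑ a ∈ t, f a ∈ nonnegCone s k :=
  Finset.sum_induction f (· ∈ nonnegCone s k) (fun _ _ => add_mem_nonnegCone hk)
    (zero_mem_nonnegCone k) h

end es

theorem sig_diagonal_eq_es (j : ℕ) (d : Fin n → ℝ) : sig j (diagonal d) = es Finset.univ j d := by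
  rw [sig, pencil_diagonal, es]

/-- The closed Gårding cone in the space of symmetric matrices. -/
def matCone (n k : ℕ) : Set (Matrix (Fin n) (Fin n) ℝ) :=
  {A | Aᵀ = A ∧ ∀ j ≤ k, 0 ≤ sig j A}

theorem isClosed_matCone (k : ℕ) : IsClosed (matCone n k) := by
  have : matCone n k = {A | Aᵀ = A} ∩ ⋂ j, ⋂ (_ : j ≤ k), {A | 0 ≤ sig j A} := by
    ext A; simp [matCone]
  rw [this]
  exact (isClosed_eq (by fun_prop) continuous_id).inter <| isClosed_iInter fun j =>
    isClosed_iInter fun _ => isClosed_le continuous_const (continuous_sig j)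

theorem smul_mem_matCone {k : ℕ} {A : Matrix (Fin n) (Fin n) ℝ} (hA : A ∈ matCone n k) {c : ℝ}
    (hc : 0 ≤ c) : c • A ∈ matCone n k :=
  ⟨by rw [transpose_smul, hA.1], fun j hj => by
    rw [sig_smul]; exact mul_nonneg (pow_nonneg hc _) (hA.2 j hj)⟩

theorem one_mem_matCone (k : ℕ) : (1 : Matrix (Fin n) (Fin n) ℝ) ∈ matCone n k :=
  ⟨transpose_one, fun j _ => sig_one_nonneg j⟩

theorem zero_mem_matCone (k : ℕ) : (0 : Matrix (Fin n) (Fin n) ℝ) ∈ matCone n k := by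
  have := smul_mem_matCone (one_mem_matCone (n := n) k) le_rfl
  rwa [zero_smul] at this

/-- The diagonal of a matrix in the Gårding cone, with respect to any orthonormal basis, lies in
the Gårding cone: by Birkhoff's theorem it is a convex combination of permutations of the vector
of eigenvalues. -/
theorem diag_conj_mem_nonnegCone {k : ℕ} (hk : k ≤ n) {A : Matrix (Fin n) (Fin n) ℝ}
    (hA : A ∈ matCone n k) {V : Matrix (Fin n) (Fin n) ℝ} (hV : V * Vᵀ = 1) (hV' : Vᵀ * V = 1) :
    diag (Vᵀ * A * V) ∈ nonnegCone Finset.univ k := by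
  have hH : A.IsHermitian := by rw [IsHermitian, conjTranspose_eq_transpose_of_trivial, hA.1]
  obtain ⟨U, h1, h2, h3⟩ := exists_orthogonal_diagonal hH
  set l := hH.eigenvalues
  have hl : l ∈ nonnegCone Finset.univ k := fun j hj => by
    rw [← sig_diagonal_eq_es, ← sig_conj j h1, ← h3]; exact hA.2 j hj
  set W := Vᵀ * U with hW
  have hW1 : W * Wᵀ = 1 := by
    rw [hW, transpose_mul, transpose_transpose, Matrix.mul_assoc, ← Matrix.mul_assoc U, h1,
      Matrix.one_mul, hV']
  have hW2 : Wᵀ * W = 1 := by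
    rw [hW, transpose_mul, transpose_transpose, Matrix.mul_assoc, ← Matrix.mul_assoc V, hV,
      Matrix.one_mul, h2]
  have hd : Matrix.of (fun i j => W i j ^ 2) ∈ doublyStochastic ℝ (Fin n) := by
    rw [mem_doublyStochastic_iff_sum]
    refine ⟨fun i j => sq_nonneg _, fun i => ?_, fun j => ?_⟩
    · have := congrFun (congrFun hW1 i) i
      simpa [Matrix.mul_apply, sq] using this
    · have := congrFun (congrFun hW2 j) j
      simpa [Matrix.mul_apply, sq] using this
  obtain ⟨w, hw0, -, hw⟩ := exists_eq_sum_perm_of_mem_doublyStochastic hd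
  have he : diag (Vᵀ * A * V) = ∑ σ, w σ • (l ∘ σ) := by
    have h4 : Vᵀ * A * V = W * diagonal l * Wᵀ := by
      rw [h3, hW, transpose_mul, transpose_transpose]
      simp only [Matrix.mul_assoc]
    have h5 : diag (Vᵀ * A * V) = Matrix.of (fun i j => W i j ^ 2) *ᵥ l := by
      ext i
      rw [h4, diag_apply, Matrix.mul_apply]
      simp only [mul_diagonal, transpose_apply, mulVec, dotProduct, of_apply]
      exact Finset.sum_congr rfl fun j _ => by ring
    rw [h5, ← hw, sum_mulVec]
    refine Finset.sum_congr rfl fun σ _ => ?_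
    rw [smul_mulVec, permMatrix_mulVec]
  rw [he]
  refine sum_mem_nonnegCone (by simpa using hk) _ fun σ _ => smul_mem_nonnegCone ?_ (hw0 σ)
  exact fun j hj => by rw [es_comp_perm]; exact hl j hj

/-- The Gårding cone is closed under addition. -/
theorem add_mem_matCone {k : ℕ} (hk : k ≤ n) {A B : Matrix (Fin n) (Fin n) ℝ}
    (hA : A ∈ matCone n k) (hB : B ∈ matCone n k) : A + B ∈ matCone n k := by
  have hs : (A + B)ᵀ = A + B := by rw [transpose_add, hA.1, hB.1]
  have hH : (A + B).IsHermitian := by rw [IsHermitian, conjTranspose_eq_transpose_of_trivial, hs]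
  obtain ⟨V, h1, h2, h3⟩ := exists_orthogonal_diagonal hH
  have he : hH.eigenvalues = diag (Vᵀ * A * V) + diag (Vᵀ * B * V) := by
    have h4 : Vᵀ * (A + B) * V = Matrix.diagonal hH.eigenvalues := by
      conv_lhs => rw [h3]
      rw [Matrix.mul_assoc V, ← Matrix.mul_assoc Vᵀ, h2, Matrix.one_mul, Matrix.mul_assoc, h2,
        Matrix.mul_one]
    rw [← diag_add, ← Matrix.add_mul, ← Matrix.mul_add, h4, diag_diagonal]
  refine ⟨hs, fun j hj => ?_⟩
  rw [h3, sig_conj j h1, sig_diagonal_eq_es, he]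
  exact add_mem_nonnegCone (by simpa using hk) (diag_conj_mem_nonnegCone hk hA h1 h2)
    (diag_conj_mem_nonnegCone hk hB h1 h2) j hj

/-- Rank-one matrices `z ⊗ z` lie in the Gårding cone: `σ_1` is the squared length of `z`, and for
`m ≥ 2` the function `c ↦ σ_m(c z ⊗ z)` is both homogeneous of degree `m` and affine. -/
theorem vecMulVec_self_mem_matCone (k : ℕ) (z : Fin n → ℝ) : vecMulVec z z ∈ matCone n k := by
  have hs : (vecMulVec z z)ᵀ = vecMulVec z z := by
    ext i j; simp [vecMulVec_apply, mul_comm]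
  refine ⟨hs, fun j _ => ?_⟩
  have h0 (m : ℕ) (c : ℝ) := sig_add_vecMulVec m (0 : Matrix (Fin n) (Fin n) ℝ) c z z
  simp only [zero_add, sig_zero_matrix (Nat.succ_ne_zero _), sig_smul] at h0
  match j with
  | 0 => simp
  | 1 =>
    have h1 := h0 0 1
    rw [tau_zero transpose_zero] at h1
    have h2 : 0 ≤ z ⬝ᵥ z := Finset.sum_nonneg fun i _ => mul_self_nonneg (z i)
    simp only [zero_add, one_pow, one_mul] at h1
    rw [h1]; exact h2
  | m + 2 =>
    have h1 := h0 (m + 1) 1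
    have h2 := h0 (m + 1) 2
    rw [one_pow, one_mul, one_mul] at h1
    rw [← h1] at h2
    have h3 : (2 : ℝ) ≤ 2 ^ (m + 1) := by
      calc (2 : ℝ) = 2 ^ 1 := by norm_num
        _ ≤ 2 ^ (m + 1) := pow_le_pow_right₀ (by norm_num) (by omega)
    have h4 : ((2 : ℝ) ^ (m + 2) - 2) * sig (m + 2) (vecMulVec z z) = 0 := by
      rw [show m + 2 = m + 1 + 1 from rfl]; linarith
    rcases mul_eq_zero.mp h4 with h5 | h5
    · rw [show m + 2 = m + 1 + 1 from rfl, pow_succ] at h5; linarith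
    · exact h5.ge

/-- The Newton transformations are nonnegative on the Gårding cone, because the cone is invariant
under the addition of `c z ⊗ z` for arbitrarily large `c`. -/
theorem tau_nonneg {k : ℕ} (hk : k ≤ n) {A : Matrix (Fin n) (Fin n) ℝ} (hA : A ∈ matCone n k)
    {m : ℕ} (hm : m < k) (z : Fin n → ℝ) : 0 ≤ tau m A z z := by
  by_contra! h
  have h1 : ∀ c : ℝ, 0 ≤ c → 0 ≤ sig (m + 1) A + c * tau m A z z := fun c hc => by
    rw [← sig_add_vecMulVec]
    exact (add_mem_matCone hk hA
      (smul_mem_matCone (vecMulVec_self_mem_matCone k z) hc)).2 _ hm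
  have h2 := h1 ((sig (m + 1) A + 1) / -tau m A z z)
    (div_nonneg (by linarith [hA.2 (m + 1) hm]) (by linarith))
  rw [div_mul_eq_mul_div, div_neg, mul_div_cancel_right₀ _ h.ne] at h2
  linarith

/-! ### The coefficients of the integrand -/

theorem sig_one_eq_trace (A : Matrix (Fin n) (Fin n) ℝ) : sig 1 A = A.trace :=
  coeff_det_one_add_X_smul_one A

theorem pencil_add_smul_one (A : Matrix (Fin n) (Fin n) ℝ) (c : ℝ) :
    pencil (A + c • 1) =
      ∑ i ∈ Finset.range (n + 1), C (sig i A) * (X ^ i * (1 + C c * X) ^ (n - i)) := by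
  have h0 : (1 + C c * X : ℝ[X]) ≠ 0 := fun h => by
    have := congrArg (eval 0) h
    simp at this
  refine mul_left_cancel₀ h0 (Polynomial.funext fun s => ?_)
  rw [eval_mul, eval_mul]
  by_cases hs : (1 + C c * X : ℝ[X]).eval s = 0
  · rw [hs, zero_mul, zero_mul]
  congr 1
  have hs' : 1 + c * s ≠ 0 := by simpa using hs
  have e : 1 + s • (A + c • 1) = (1 + c * s) • (1 + (s / (1 + c * s)) • A) := by
    rw [smul_add, smul_add, smul_smul, smul_smul, mul_div_cancel₀ _ hs', add_smul, one_smul,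
      mul_comm c]
    abel
  rw [eval_pencil, e, det_smul, Fintype.card_fin, ← eval_pencil,
    eval_eq_sum_range' (Nat.lt_succ_of_le (natDegree_pencil_le A)), Finset.mul_sum,
    eval_finsetSum]
  refine Finset.sum_congr rfl fun i hi => ?_
  simp only [eval_mul, eval_C, eval_pow, eval_X, eval_add, eval_one]
  obtain ⟨m, rfl⟩ := Nat.exists_eq_add_of_le (Nat.lt_succ_iff.mp (Finset.mem_range.mp hi))
  rw [Nat.add_sub_cancel_left, div_pow, pow_add, sig]
  field_simp

theorem sig_add_smul_one (j : ℕ) (hj : j ≤ n) (A : Matrix (Fin n) (Fin n) ℝ) (c : ℝ) :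
    sig j (A + c • 1) =
      ∑ i ∈ Finset.range (j + 1), ((n - i).choose (j - i) : ℝ) * c ^ (j - i) * sig i A := by
  rw [sig, pencil_add_smul_one, finsetSum_coeff]
  have h : ∀ i, (C (sig i A) * (X ^ i * (1 + C c * X) ^ (n - i))).coeff j =
      if i ≤ j then ((n - i).choose (j - i) : ℝ) * c ^ (j - i) * sig i A else 0 := fun i => by
    rw [coeff_C_mul, coeff_X_pow_mul', coeff_one_add_C_mul_X_pow, mul_comm, ite_mul, zero_mul]
  simp_rw [h]
  rw [← Finset.sum_subset (Finset.range_mono (Nat.succ_le_succ hj))]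
  · exact Finset.sum_congr rfl fun i hi => if_pos (Nat.lt_succ_iff.mp (Finset.mem_range.mp hi))
  · intro i _ hi
    exact if_neg fun h => hi (Finset.mem_range.mpr (Nat.lt_succ_of_le h))

/-- The binomial coefficient `(a + N) choose N` for real `a`. -/
def riseBinom (a : ℝ) (N : ℕ) : ℝ := (∏ t ∈ Finset.range N, (a + 1 + t)) / N.factorial

/-- The binomial coefficient `a choose N` for real `a`. -/
def fallBinom (a : ℝ) (N : ℕ) : ℝ := (∏ t ∈ Finset.range N, (a - t)) / N.factorial

theorem riseBinom_zero (a : ℝ) : riseBinom a 0 = 1 := by simp [riseBinom]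

theorem riseBinom_succ (a : ℝ) (N : ℕ) :
    (N + 1) * riseBinom a (N + 1) = (a + 1 + N) * riseBinom a N := by
  rw [riseBinom, riseBinom, Finset.prod_range_succ, Nat.factorial_succ]
  have : (N.factorial : ℝ) ≠ 0 := by exact_mod_cast N.factorial_ne_zero
  push_cast
  field_simp

theorem riseBinom_sub_one (a : ℝ) (N : ℕ) :
    riseBinom (a - 1) (N + 1) = riseBinom a (N + 1) - riseBinom a N := by
  induction N with
  | zero => simp [riseBinom]
  | succ N ih =>
    have h1 := riseBinom_succ (a - 1) (N + 1)
    have h2 := riseBinom_succ a (N + 1)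
    have h3 := riseBinom_succ a N
    rw [ih] at h1
    push_cast at h1 h2
    have : (N + 1 + 1 : ℝ) ≠ 0 := by positivity
    refine mul_left_cancel₀ this ?_
    linear_combination h1 - h2 + h3

theorem riseBinom_sub_natCast_self (a : ℝ) (N : ℕ) : riseBinom (a - N) N = fallBinom a N := by
  rw [riseBinom, fallBinom, ← Finset.prod_range_reflect]
  congr 1
  refine Finset.prod_congr rfl fun t ht => ?_
  have := Finset.mem_range.mp ht
  rw [Nat.sub_sub, Nat.cast_sub (by omega)]
  push_cast
  ring

theorem fallBinom_succ (a : ℝ) (N : ℕ) :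
    (N + 1) * fallBinom a (N + 1) = (a - N) * fallBinom a N := by
  rw [fallBinom, fallBinom, Finset.prod_range_succ, Nat.factorial_succ]
  have : (N.factorial : ℝ) ≠ 0 := by exact_mod_cast N.factorial_ne_zero
  push_cast
  field_simp

theorem fallBinom_succ' (a : ℝ) (N : ℕ) :
    (N + 1) * fallBinom a (N + 1) = a * fallBinom (a - 1) N := by
  rw [fallBinom, fallBinom, Finset.prod_range_succ', Nat.factorial_succ]
  have : (N.factorial : ℝ) ≠ 0 := by exact_mod_cast N.factorial_ne_zero
  have h : ∀ t : ℕ, a - ((t + 1 : ℕ) : ℝ) = a - 1 - t := fun t => by push_cast; ring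
  simp_rw [h]
  push_cast
  field_simp
  ring

/-- A Chu–Vandermonde identity: multiplying the generating function `(1 - t) ^ (-a - 1)` by
`(1 - t) ^ m` shifts the exponent. -/
theorem sum_choose_mul_riseBinom (m : ℕ) (a : ℝ) (N : ℕ) :
    ∑ i ∈ Finset.range (N + 1), (-1) ^ i * (m.choose i : ℝ) * riseBinom a (N - i) =
      riseBinom (a - m) N := by
  induction m generalizing N with
  | zero =>
    rw [Finset.sum_range_succ']
    simp
  | succ m ih =>
    cases N with
    | zero => simp [riseBinom_zero]
    | succ N =>
      have h1 := ih (N + 1)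
      have h2 := ih N
      rw [Finset.sum_range_succ'] at h1 ⊢
      have e : a - ((m + 1 : ℕ) : ℝ) = a - m - 1 := by push_cast; ring
      rw [e, riseBinom_sub_one, ← h1, ← h2]
      have h3 : ∀ i : ℕ, (-1) ^ (i + 1) * ((m + 1).choose (i + 1) : ℝ) *
          riseBinom a (N + 1 - (i + 1)) =
          (-1) ^ (i + 1) * (m.choose (i + 1) : ℝ) * riseBinom a (N + 1 - (i + 1)) -
          (-1) ^ i * (m.choose i : ℝ) * riseBinom a (N - i) := fun i => by
        rw [Nat.choose_succ_succ, Nat.add_sub_add_right]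
        push_cast
        ring
      simp_rw [h3, Finset.sum_sub_distrib]
      simp
      ring

theorem b_nonneg {k : ℕ} (hk : 1 ≤ k) (hkn : k ≤ n) {α : ℝ} (hα : 0 ≤ α) (l : ℕ) :
    0 ≤ b n k α l := by
  have hn : (1 : ℝ) ≤ n := by exact_mod_cast hk.trans hkn
  have hl : (0 : ℝ) ≤ l := l.cast_nonneg
  have h1 := Real.Gamma_pos_of_pos (show 0 < α + n + l by linarith)
  have h2 := Real.Gamma_pos_of_pos (show 0 < α + n + 1 by linarith)
  unfold b
  positivity

theorem gamma_add_nat (x : ℝ) (hx : 0 < x) (l : ℕ) :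
    Real.Gamma (x + l) = (∏ t ∈ Finset.range l, (x + t)) * Real.Gamma x := by
  induction l with
  | zero => simp
  | succ l ih =>
    have : x + l ≠ 0 := by positivity
    rw [Nat.cast_succ, ← add_assoc, Real.Gamma_add_one this, ih, Finset.prod_range_succ]
    ring

theorem b_zero {k : ℕ} (hn : 1 ≤ n) {α : ℝ} (hα : 0 ≤ α) : b n k α 0 = k := by
  have hn' : (1 : ℝ) ≤ n := by exact_mod_cast hn
  have hx : 0 < α + n := by linarith
  have h2 := (Real.Gamma_pos_of_pos hx).ne'
  rw [b, Real.Gamma_add_one hx.ne']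
  simp
  field_simp

/-- The coefficients `b` in terms of binomial coefficients. -/
theorem two_pow_mul_b_succ {k : ℕ} (hn : 1 ≤ n) {α : ℝ} (hα : 0 ≤ α) (l : ℕ) :
    2 ^ (l + 1) * b n k α (l + 1) =
      k * riseBinom (α + n) (l + 1) + (α + k) * riseBinom (α + n) l := by
  have hn' : (1 : ℝ) ≤ n := by exact_mod_cast hn
  have hx : 0 < α + n + 1 := by linarith
  have h2 := (Real.Gamma_pos_of_pos hx).ne'
  have h3 : (l.factorial : ℝ) ≠ 0 := by exact_mod_cast l.factorial_ne_zero
  have e : α + n + ((l + 1 : ℕ) : ℝ) = α + n + 1 + l := by push_cast; ring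
  have h4 := riseBinom_succ (α + n) l
  have hl : (l + 1 : ℝ) ≠ 0 := by positivity
  have h5 : riseBinom (α + n) (l + 1) = (α + n + 1 + l) * riseBinom (α + n) l / (l + 1) := by
    rw [← h4]; field_simp
  rw [h5, b, e, gamma_add_nat _ hx, riseBinom, Nat.factorial_succ]
  push_cast
  field_simp
  ring

/-- The coefficients of the expansion of the integrand in powers of `w` and `|∇w|²`. -/
def cCoeff (k : ℕ) (α : ℝ) (i : ℕ) : ℝ :=
  (k + (k - i : ℕ)) * ((1 / 2) ^ (k - i) * fallBinom (α + k) (k - i))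

/-- The convolution that turns the coefficients `b` into `cCoeff`, evaluated with the
Chu–Vandermonde identity. -/
theorem sum_b_mul_choose {k : ℕ} (hk : 1 ≤ k) (hkn : k ≤ n) {α : ℝ} (hα : 0 ≤ α) {N : ℕ}
    (hN : N ≤ k) : ∑ l ∈ Finset.range (N + 1),
      b n k α l * ((n - (k - N)).choose (N - l) : ℝ) * (-1 / 2) ^ (N - l) =
      (k + N) * ((1 / 2) ^ N * fallBinom (α + k) N) := by
  have hn := hk.trans hkn
  set m := n - (k - N) with hm
  have hx : α + n - m = α + k - N := by
    rw [hm, Nat.cast_sub (by omega), Nat.cast_sub hN]; ring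
  have hV := sum_choose_mul_riseBinom m (α + n) N
  rw [hx, riseBinom_sub_natCast_self] at hV
  rw [← Finset.sum_range_reflect] at hV
  have hb : ∀ l ≤ N, (-1 / 2 : ℝ) ^ (N - l) = (1 / 2) ^ N * (2 ^ l * (-1) ^ (N - l)) := by
    intro l hl
    obtain ⟨i, rfl⟩ := Nat.exists_eq_add_of_le hl
    rw [Nat.add_sub_cancel_left, pow_add, div_pow, div_pow, div_pow]
    field_simp
    simp
  have hS : ∑ l ∈ Finset.range (N + 1),
      b n k α l * (m.choose (N - l) : ℝ) * (-1 / 2) ^ (N - l) = (1 / 2) ^ N *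
      ∑ l ∈ Finset.range (N + 1), (2 ^ l * b n k α l) * ((-1) ^ (N - l) * (m.choose (N - l))) := by
    rw [Finset.mul_sum]
    refine Finset.sum_congr rfl fun l hl => ?_
    rw [hb l (Nat.lt_succ_iff.mp (Finset.mem_range.mp hl))]
    ring
  have hV' : ∑ l ∈ Finset.range (N + 1), riseBinom (α + n) l *
      ((-1) ^ (N - l) * (m.choose (N - l) : ℝ)) = fallBinom (α + k) N := by
    rw [← hV]
    refine Finset.sum_congr rfl fun l hl => ?_
    have := Finset.mem_range.mp hl
    rw [Nat.add_sub_cancel, Nat.sub_sub_self (by omega)]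
    ring
  rw [hS]
  cases N with
  | zero => simp [b_zero hn hα, fallBinom]
  | succ N =>
    have hV2 := sum_choose_mul_riseBinom m (α + n) N
    have hx2 : α + n - m = α + k - 1 - N := by rw [hx]; push_cast; ring
    rw [hx2, riseBinom_sub_natCast_self, ← Finset.sum_range_reflect] at hV2
    have hV3 : ∑ l ∈ Finset.range (N + 1), riseBinom (α + n) l *
        ((-1) ^ (N - l) * (m.choose (N - l) : ℝ)) = fallBinom (α + k - 1) N := by
      rw [← hV2]
      refine Finset.sum_congr rfl fun l hl => ?_
      have := Finset.mem_range.mp hl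
      rw [Nat.add_sub_cancel, Nat.sub_sub_self (by omega)]
      ring
    have hf := fallBinom_succ' (α + k) N
    rw [Finset.sum_range_succ'] at hV' ⊢
    simp only [two_pow_mul_b_succ hn hα, b_zero hn hα, riseBinom_zero,
      Nat.sub_zero, Nat.add_sub_add_right, add_mul, Finset.sum_add_distrib, mul_assoc,
      ← Finset.mul_sum] at hV' ⊢
    rw [hV3]
    push_cast
    linear_combination (1 / 2 : ℝ) ^ (N + 1) * k * hV' - (1 / 2 : ℝ) ^ (N + 1) * hf

/-- The integrand without the factor `w ^ α`, as a function of the value `w`, the squared length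
`q` of the gradient and the Hessian `r`. -/
def Psi (k : ℕ) (α w q : ℝ) (r : Matrix (Fin n) (Fin n) ℝ) : ℝ :=
  ∑ l ∈ Finset.range (k + 1), b n k α l * q ^ l * sig (k - l) (w • r - (1 / 2 * q) • 1)

/-- Expansion of the integrand in powers of `w`, `q` and in the functions `σ_i(r)` of the Hessian
itself. -/
theorem Psi_eq_sum {k : ℕ} (hk : 1 ≤ k) (hkn : k ≤ n) {α : ℝ} (hα : 0 ≤ α) (w q : ℝ)
    (r : Matrix (Fin n) (Fin n) ℝ) :
    Psi k α w q r =
      ∑ i ∈ Finset.range (k + 1), cCoeff k α i * w ^ i * q ^ (k - i) * sig i r := by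
  have h1 : ∀ l ∈ Finset.range (k + 1),
      b n k α l * q ^ l * sig (k - l) (w • r - (1 / 2 * q) • 1) =
      ∑ i ∈ Finset.range (k - l + 1), b n k α l * ((n - i).choose (k - i - l) : ℝ) *
        (-1 / 2) ^ (k - i - l) * (w ^ i * q ^ (k - i) * sig i r) := by
    intro l hl
    have hl := Nat.lt_succ_iff.mp (Finset.mem_range.mp hl)
    rw [sub_eq_add_neg, ← neg_smul, sig_add_smul_one _ (by omega), Finset.mul_sum]
    refine Finset.sum_congr rfl fun i hi => ?_
    have hi := Nat.lt_succ_iff.mp (Finset.mem_range.mp hi)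
    have e : k - i = l + (k - l - i) := by omega
    rw [sig_smul, show k - i - l = k - l - i by omega, e, pow_add,
      show -(1 / 2 * q) = -1 / 2 * q by ring, mul_pow]
    ring
  rw [Psi, Finset.sum_congr rfl h1, Finset.sum_sigma', Finset.sum_bij' (t := (Finset.range
    (k + 1)).sigma fun i => Finset.range (k - i + 1)) (i := fun x _ => ⟨x.2, x.1⟩)
    (j := fun x _ => ⟨x.2, x.1⟩) (g := fun x => b n k α x.2 *
      ((n - x.1).choose (k - x.1 - x.2) : ℝ) * (-1 / 2) ^ (k - x.1 - x.2) *
      (w ^ x.1 * q ^ (k - x.1) * sig x.1 r))]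
  · rw [← Finset.sum_sigma' (Finset.range (k + 1)) (fun i => Finset.range (k - i + 1))
      (fun i l => b n k α l * ((n - i).choose (k - i - l) : ℝ) * (-1 / 2) ^ (k - i - l) *
      (w ^ i * q ^ (k - i) * sig i r))]
    refine Finset.sum_congr rfl fun i hi => ?_
    have hi := Nat.lt_succ_iff.mp (Finset.mem_range.mp hi)
    rw [← Finset.sum_mul, cCoeff]
    have := sum_b_mul_choose hk hkn hα (Nat.sub_le k i)
    rw [Nat.sub_sub_self hi] at this
    rw [this]
    ring
  all_goals grind

/-- The coefficient of the rank-one matrix `z ⊗ z` in the integrand. -/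
def rankOneCoeff (k : ℕ) (α w q : ℝ) (r : Matrix (Fin n) (Fin n) ℝ) (z : Fin n → ℝ) : ℝ :=
  ∑ m ∈ Finset.range k, cCoeff k α (m + 1) * w ^ (m + 1) * q ^ (k - (m + 1)) * tau m r z z

theorem Psi_add_vecMulVec {k : ℕ} (hk : 1 ≤ k) (hkn : k ≤ n) {α : ℝ} (hα : 0 ≤ α) (w q : ℝ)
    (r : Matrix (Fin n) (Fin n) ℝ) (c : ℝ) (z : Fin n → ℝ) :
    Psi k α w q (r + c • vecMulVec z z) = Psi k α w q r + c * rankOneCoeff k α w q r z := by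
  rw [Psi_eq_sum hk hkn hα, Psi_eq_sum hk hkn hα, Finset.sum_range_succ', Finset.sum_range_succ',
    rankOneCoeff, Finset.mul_sum, sig_zero, sig_zero, add_right_comm, ← Finset.sum_add_distrib]
  congr 1
  refine Finset.sum_congr rfl fun m _ => ?_
  rw [sig_add_vecMulVec]
  ring

/-! ### Admissible 2-jets -/

/-- A 2-jet `(w, p, r)` is admissible if it satisfies the linear constraints
`r - (ξ · p - |ξ|² w / 2) 1 ∈ Γ_k` for all `ξ`. For `w > 0` they are together equivalent to
`w r - |p|² / 2 ∈ Γ_k`. -/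
def JetAdm (k : ℕ) (w : ℝ) (p : EuclideanSpace ℝ (Fin n)) (r : Matrix (Fin n) (Fin n) ℝ) : Prop :=
  0 ≤ w ∧ ∀ ξ : EuclideanSpace ℝ (Fin n),
    r - (inner ℝ ξ p - ‖ξ‖ ^ 2 / 2 * w) • (1 : Matrix (Fin n) (Fin n) ℝ) ∈ matCone n k

theorem JetAdm.combine {k : ℕ} (hk : k ≤ n) {w w' : ℝ} {p p' : EuclideanSpace ℝ (Fin n)}
    {r r' : Matrix (Fin n) (Fin n) ℝ} (h : JetAdm k w p r) (h' : JetAdm k w' p' r') {s t : ℝ}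
    (hs : 0 ≤ s) (ht : 0 ≤ t) : JetAdm k (s * w + t * w') (s • p + t • p') (s • r + t • r') := by
  refine ⟨add_nonneg (mul_nonneg hs h.1) (mul_nonneg ht h'.1), fun ξ => ?_⟩
  have := add_mem_matCone hk (smul_mem_matCone (h.2 ξ) hs) (smul_mem_matCone (h'.2 ξ) ht)
  convert this using 1
  rw [inner_add_right, inner_smul_right, inner_smul_right, smul_sub, smul_sub, smul_smul,
    smul_smul]
  rw [sub_add_sub_comm, ← add_smul]
  congr 2
  ring

/-- The gradient of an admissible jet of value zero vanishes, since the trace of the constraint is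
affine in `ξ` and bounded below. -/
theorem JetAdm.gradient_eq_zero {k : ℕ} (hk : 1 ≤ k) (hkn : k ≤ n)
    {p : EuclideanSpace ℝ (Fin n)} {r : Matrix (Fin n) (Fin n) ℝ} (h : JetAdm k 0 p r) :
    p = 0 := by
  by_contra hp
  have hp' : 0 < ‖p‖ ^ 2 := by positivity
  have hn : (1 : ℝ) ≤ n := by exact_mod_cast hk.trans hkn
  have h1 := (h.2 (((r.trace + 1) / (n * ‖p‖ ^ 2)) • p)).2 1 hk
  rw [sig_one_eq_trace, trace_sub, trace_smul, trace_one, inner_smul_left,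
    real_inner_self_eq_norm_sq] at h1
  simp only [conj_trivial, mul_zero, sub_zero, Fintype.card_fin, smul_eq_mul] at h1
  have h2 : (r.trace + 1) / (n * ‖p‖ ^ 2) * ‖p‖ ^ 2 * n = r.trace + 1 := by
    field_simp
  linarith

/-- For `w > 0` the constraint with `ξ = p / w`, multiplied by `w`, is the nonlinear one; for
`w = 0` the matrix is zero. -/
theorem JetAdm.schouten_mem {k : ℕ} (hk : 1 ≤ k) (hkn : k ≤ n) {w : ℝ}
    {p : EuclideanSpace ℝ (Fin n)} {r : Matrix (Fin n) (Fin n) ℝ} (h : JetAdm k w p r) :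
    w • r - (1 / 2 * ‖p‖ ^ 2) • 1 ∈ matCone n k := by
  rcases h.1.eq_or_lt with h0 | h0
  · subst h0
    rw [h.gradient_eq_zero hk hkn]
    simpa using zero_mem_matCone k
  · have h1 := smul_mem_matCone (h.2 (w⁻¹ • p)) h.1
    convert h1 using 1
    rw [smul_sub, smul_smul, inner_smul_left, real_inner_self_eq_norm_sq, norm_smul, norm_inv,
      Real.norm_of_nonneg h.1]
    simp only [conj_trivial]
    congr 2
    field_simp
    ring

/-- The nonlinear constraint implies all the linear ones: they differ by the multiple
`|p - w ξ|² / (2 w)` of the identity matrix. -/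
theorem JetAdm.of_schouten_mem {k : ℕ} (hkn : k ≤ n) {w : ℝ} (hw : 0 < w)
    {p : EuclideanSpace ℝ (Fin n)} {r : Matrix (Fin n) (Fin n) ℝ}
    (h : w • r - (1 / 2 * ‖p‖ ^ 2) • 1 ∈ matCone n k) : JetAdm k w p r := by
  refine ⟨hw.le, fun ξ => ?_⟩
  have h1 := smul_mem_matCone (add_mem_matCone hkn h (smul_mem_matCone (one_mem_matCone k)
    (show 0 ≤ 1 / 2 * ‖p - w • ξ‖ ^ 2 by positivity))) (inv_nonneg.mpr hw.le)
  convert h1 using 1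
  rw [norm_sub_sq_real, inner_smul_right, norm_smul, Real.norm_of_nonneg hw.le, smul_add,
    smul_sub, smul_smul, smul_smul, smul_smul, inv_mul_cancel₀ hw.ne', one_smul,
    sub_add, ← sub_smul, real_inner_comm]
  congr 2
  field_simp
  ring

/-- Ellipticity of the integrand at admissible jets. -/
theorem JetAdm.rankOneCoeff_nonneg {k : ℕ} (hk : 1 ≤ k) (hkn : k ≤ n) {α : ℝ} (hα : 0 ≤ α)
    {w : ℝ} {p : EuclideanSpace ℝ (Fin n)} {r : Matrix (Fin n) (Fin n) ℝ} (h : JetAdm k w p r)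
    (z : Fin n → ℝ) : 0 ≤ rankOneCoeff k α w (‖p‖ ^ 2) r z := by
  have h1 := Psi_add_vecMulVec hk hkn hα w (‖p‖ ^ 2) r 1 z
  have h2 : Psi k α w (‖p‖ ^ 2) r ≤ Psi k α w (‖p‖ ^ 2) (r + (1 : ℝ) • vecMulVec z z) := by
    refine Finset.sum_le_sum fun l hl => ?_
    refine mul_le_mul_of_nonneg_left ?_ (mul_nonneg (b_nonneg hk hkn hα l) (by positivity))
    rw [one_smul, smul_add, add_sub_right_comm]
    cases hm : k - l with
    | zero => simp
    | succ m =>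
      rw [sig_add_vecMulVec]
      have := tau_nonneg hkn (h.schouten_mem hk hkn) (show m < k by omega) z
      nlinarith [mul_nonneg h.1 this]
  linarith

end Algebra

section Analysis

open Matrix

variable {n : ℕ}

/-! ### Admissibility of the 2-jets of limits in `L¹_loc` -/

/-- The Euclidean space in which the domains lie. -/
abbrev Sp (n : ℕ) : Type := EuclideanSpace ℝ (Fin n)

/-- The partial derivative `∂_i v`. -/
def pd (i : Fin n) (v : Sp n → ℝ) (x : Sp n) : ℝ := fderiv ℝ v x (EuclideanSpace.single i 1)

theorem hessian_apply (v : Sp n → ℝ) (x : Sp n) (i j : Fin n) :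
    hessian v x i j = pd j (pd i v) x := rfl

theorem gradient_apply (v : Sp n → ℝ) (x : Sp n) (i : Fin n) : gradient v x i = pd i v x := by
  have h : inner ℝ (gradient v x) (EuclideanSpace.single i (1 : ℝ)) = pd i v x := by
    rw [gradient, InnerProductSpace.toDual_symm_apply, pd]
  rw [← h, EuclideanSpace.inner_single_right]
  simp

theorem contDiffOn_pd {Ω : Set (Sp n)} (hΩ : IsOpen Ω) {m : WithTop ℕ∞} {v : Sp n → ℝ}
    (hv : ContDiffOn ℝ (m + 1) v Ω) (i : Fin n) : ContDiffOn ℝ m (pd i v) Ω :=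
  (hv.fderiv_of_isOpen hΩ le_rfl).clm_apply contDiffOn_const

theorem contDiff_pd {m : WithTop ℕ∞} {v : Sp n → ℝ}
    (hv : ContDiff ℝ (m + 1) v) (i : Fin n) : ContDiff ℝ m (pd i v) :=
  contDiffOn_univ.mp (contDiffOn_pd isOpen_univ hv.contDiffOn i)

theorem continuousOn_gradient {Ω : Set (Sp n)} (hΩ : IsOpen Ω) {v : Sp n → ℝ}
    (hv : ContDiffOn ℝ 1 v Ω) : ContinuousOn (gradient v) Ω :=
  (LinearIsometryEquiv.continuous _).comp_continuousOn (hv.continuousOn_fderiv_of_isOpen hΩ le_rfl)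

theorem continuousOn_hessian {Ω : Set (Sp n)} (hΩ : IsOpen Ω) {v : Sp n → ℝ}
    (hv : ContDiffOn ℝ 2 v Ω) : ContinuousOn (hessian v) Ω := by
  refine continuousOn_pi.mpr fun i => continuousOn_pi.mpr fun j => ?_
  have h1 : ContDiffOn ℝ 1 (pd i v) Ω := contDiffOn_pd hΩ (by simpa [one_add_one_eq_two] using hv) i
  have h2 : ContDiffOn ℝ 0 (pd j (pd i v)) Ω := contDiffOn_pd hΩ (by simpa using h1) j
  exact h2.continuousOn

theorem hessian_transpose {Ω : Set (Sp n)} (hΩ : IsOpen Ω) {v : Sp n → ℝ}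
    (hv : ContDiffOn ℝ 2 v Ω) {x : Sp n} (hx : x ∈ Ω) : (hessian v x)ᵀ = hessian v x := by
  have hv' := hv.contDiffAt (hΩ.mem_nhds hx)
  have hs := hv'.isSymmSndFDerivAt (by simp)
  have hd : DifferentiableAt ℝ (fderiv ℝ v) x :=
    ((hv.fderiv_of_isOpen hΩ (m := 1) (by rw [one_add_one_eq_two])).differentiableOn
      one_ne_zero).differentiableAt (hΩ.mem_nhds hx)
  have h : ∀ i j, hessian v x i j = fderiv ℝ (fderiv ℝ v) x (EuclideanSpace.single j 1)
      (EuclideanSpace.single i 1) := fun i j => by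
    change fderiv ℝ (fun y => fderiv ℝ v y (EuclideanSpace.single i 1)) x _ = _
    rw [fderiv_clm_apply hd (by fun_prop)]
    simp
  ext i j
  rw [transpose_apply, h, h, hs.eq]

theorem schouten_mem_matCone {k : ℕ} {Ω : Set (Sp n)} (hΩ : IsOpen Ω) {w : Sp n → ℝ}
    (hw : PhiTilde k Ω w) {x : Sp n} (hx : x ∈ Ω) :
    w x • hessian w x - (1 / 2 * ‖gradient w x‖ ^ 2) • 1 ∈ matCone n k := by
  have hs : (schouten w x)ᵀ = schouten w x := by
    rw [schouten, transpose_sub, transpose_smul, transpose_smul, transpose_one,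
      hessian_transpose hΩ hw.contDiffOn hx]
  have hH : (schouten w x).IsHermitian := by
    rw [IsHermitian, conjTranspose_eq_transpose_of_trivial, hs]
  refine ⟨hs, fun j hj => ?_⟩
  rcases Nat.eq_zero_or_pos j with rfl | hj0
  · simp
  · have := hw.mem_cone x hx j hj0 hj
    rwa [sigma_eigenvalues j hH] at this

theorem PhiTilde.jetAdm {k : ℕ} (hkn : k ≤ n) {Ω : Set (Sp n)} (hΩ : IsOpen Ω) {w : Sp n → ℝ}
    (hw : PhiTilde k Ω w) {x : Sp n} (hx : x ∈ Ω) :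
    JetAdm k (w x) (gradient w x) (hessian w x) :=
  .of_schouten_mem hkn (hw.pos x hx) (schouten_mem_matCone hΩ hw hx)

theorem continuous_mul_of_tsupport_subset {Ω : Set (Sp n)} (hΩ : IsOpen Ω) {ρ g : Sp n → ℝ}
    (hρ : Continuous ρ) (hs : tsupport ρ ⊆ Ω) (hg : ContinuousOn g Ω) :
    Continuous fun x => ρ x * g x :=
  (hρ.continuousOn.mul hg).continuous_of_tsupport_subset hΩ
    (tsupport_mul_subset_left.trans hs)

theorem integrable_mul_of_tsupport_subset {Ω : Set (Sp n)} (hΩ : IsOpen Ω) {ρ g : Sp n → ℝ}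
    (hρ : Continuous ρ) (hc : HasCompactSupport ρ) (hs : tsupport ρ ⊆ Ω)
    (hg : ContinuousOn g Ω) : Integrable (fun x => ρ x * g x) :=
  (continuous_mul_of_tsupport_subset hΩ hρ hs hg).integrable_of_hasCompactSupport hc.mul_right

theorem tsupport_pd_subset (i : Fin n) (ρ : Sp n → ℝ) : tsupport (pd i ρ) ⊆ tsupport ρ :=
  tsupport_fderiv_apply_subset ℝ _

theorem hasCompactSupport_pd {ρ : Sp n → ℝ} (h : HasCompactSupport ρ) (i : Fin n) :
    HasCompactSupport (pd i ρ) := h.fderiv_apply ℝ _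

/-- Integration by parts against a test function supported in `Ω`. -/
theorem integral_mul_pd {Ω : Set (Sp n)} (hΩ : IsOpen Ω) {ρ g : Sp n → ℝ}
    (hρ : ContDiff ℝ 1 ρ) (hc : HasCompactSupport ρ) (hs : tsupport ρ ⊆ Ω)
    (hg : ContDiffOn ℝ 1 g Ω) (i : Fin n) :
    ∫ x, ρ x * pd i g x = -∫ x, pd i ρ x * g x := by
  have h1 : ContDiff ℝ 0 (pd i ρ) := contDiff_pd (by simpa using hρ) i
  have h2 : ContDiffOn ℝ 0 (pd i g) Ω := contDiffOn_pd hΩ (by simpa using hg) i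
  refine integral_mul_fderiv_eq_neg_fderiv_mul_of_integrable ?_ ?_ ?_ ?_ ?_
  · exact integrable_mul_of_tsupport_subset hΩ h1.continuous (hasCompactSupport_pd hc i)
      ((tsupport_pd_subset i ρ).trans hs) hg.continuousOn
  · exact integrable_mul_of_tsupport_subset hΩ hρ.continuous hc hs h2.continuousOn
  · exact integrable_mul_of_tsupport_subset hΩ hρ.continuous hc hs hg.continuousOn
  · exact fun x _ => hρ.differentiable one_ne_zero x
  · exact fun x hx => (hg.differentiableOn one_ne_zero).differentiableAt (hΩ.mem_nhds (hs hx))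

/-- The constant-coefficient operator `a_ij ∂_ij - β_i ∂_i + γ`. -/
def linOp (a : Fin n → Fin n → ℝ) (β : Fin n → ℝ) (γ : ℝ) (w : Sp n → ℝ) (x : Sp n) : ℝ :=
  (∑ i, ∑ j, a i j * pd j (pd i w) x) - (∑ i, β i * pd i w x) + γ * w x

/-- The formal adjoint of `linOp`. -/
def linOpAdj (a : Fin n → Fin n → ℝ) (β : Fin n → ℝ) (γ : ℝ) (ρ : Sp n → ℝ) (x : Sp n) : ℝ :=
  (∑ i, ∑ j, a i j * pd i (pd j ρ) x) + (∑ i, β i * pd i ρ x) + γ * ρ x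

theorem integral_mul_linOp {Ω : Set (Sp n)} (hΩ : IsOpen Ω) {ρ w : Sp n → ℝ}
    (hρ : ContDiff ℝ 2 ρ) (hc : HasCompactSupport ρ) (hs : tsupport ρ ⊆ Ω)
    (hw : ContDiffOn ℝ 2 w Ω) (a : Fin n → Fin n → ℝ) (β : Fin n → ℝ) (γ : ℝ) :
    ∫ x, ρ x * linOp a β γ w x = ∫ x, linOpAdj a β γ ρ x * w x := by
  have e2 : (2 : WithTop ℕ∞) = 1 + 1 := one_add_one_eq_two.symm
  have hρ1 : ContDiff ℝ 1 ρ := hρ.of_le (by norm_num)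
  have hw1 : ContDiffOn ℝ 1 w Ω := hw.of_le (by norm_num)
  have hpw (i) : ContDiffOn ℝ 1 (pd i w) Ω := contDiffOn_pd hΩ (e2 ▸ hw) i
  have hpρ (i) : ContDiff ℝ 1 (pd i ρ) := contDiff_pd (e2 ▸ hρ) i
  have hppw (i j) : ContDiffOn ℝ 0 (pd j (pd i w)) Ω := contDiffOn_pd hΩ (by simpa using hpw i) j
  have hppρ (i j) : ContDiff ℝ 0 (pd j (pd i ρ)) := contDiff_pd (by simpa using hpρ i) j
  have hts (i) : tsupport (pd i ρ) ⊆ Ω := (tsupport_pd_subset i ρ).trans hs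
  have htss (i j) : tsupport (pd i (pd j ρ)) ⊆ Ω := (tsupport_pd_subset i _).trans (hts j)
  have hI0 := integrable_mul_of_tsupport_subset hΩ hρ.continuous hc hs hw.continuousOn
  have hI1 (i) := integrable_mul_of_tsupport_subset hΩ hρ.continuous hc hs (hpw i).continuousOn
  have hI2 (i j) := integrable_mul_of_tsupport_subset hΩ hρ.continuous hc hs (hppw i j).continuousOn
  have hJ1 (i) := integrable_mul_of_tsupport_subset hΩ (hpρ i).continuous
    (hasCompactSupport_pd hc i) (hts i) hw.continuousOn
  have hJ2 (i j) := integrable_mul_of_tsupport_subset hΩ (hppρ j i).continuous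
    (hasCompactSupport_pd (hasCompactSupport_pd hc j) i) (htss i j) hw.continuousOn
  have hP1 (i) := integral_mul_pd hΩ hρ1 hc hs hw1 i
  have hP2 (i j) : ∫ x, ρ x * pd j (pd i w) x = ∫ x, pd i (pd j ρ) x * w x := by
    rw [integral_mul_pd hΩ hρ1 hc hs (hpw i) j, integral_mul_pd hΩ (hpρ j)
      (hasCompactSupport_pd hc j) (hts j) hw1 i, neg_neg]
  have e1 : ∀ x, ρ x * linOp a β γ w x = (∑ i, ∑ j, a i j * (ρ x * pd j (pd i w) x)) -
      (∑ i, β i * (ρ x * pd i w x)) + γ * (ρ x * w x) := fun x => by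
    rw [linOp, mul_add, mul_sub, Finset.mul_sum, Finset.mul_sum]
    simp_rw [Finset.mul_sum, mul_left_comm]
  have e3 : ∀ x, linOpAdj a β γ ρ x * w x = (∑ i, ∑ j, a i j * (pd i (pd j ρ) x * w x)) +
      (∑ i, β i * (pd i ρ x * w x)) + γ * (ρ x * w x) := fun x => by
    rw [linOpAdj, add_mul, add_mul, Finset.sum_mul, Finset.sum_mul]
    simp_rw [Finset.sum_mul, mul_assoc]
  have hS2 : Integrable fun x => ∑ i, ∑ j, a i j * (ρ x * pd j (pd i w) x) :=
    integrable_finsetSum _ fun i _ => integrable_finsetSum _ fun j _ => (hI2 i j).const_mul _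
  have hS1 : Integrable fun x => ∑ i, β i * (ρ x * pd i w x) :=
    integrable_finsetSum _ fun i _ => (hI1 i).const_mul _
  have hT2 : Integrable fun x => ∑ i, ∑ j, a i j * (pd i (pd j ρ) x * w x) :=
    integrable_finsetSum _ fun i _ => integrable_finsetSum _ fun j _ => (hJ2 i j).const_mul _
  have hT1 : Integrable fun x => ∑ i, β i * (pd i ρ x * w x) :=
    integrable_finsetSum _ fun i _ => (hJ1 i).const_mul _
  have hS : Integrable fun x => (∑ i, ∑ j, a i j * (ρ x * pd j (pd i w) x)) -
      ∑ i, β i * (ρ x * pd i w x) := hS2.sub hS1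
  have hT : Integrable fun x => (∑ i, ∑ j, a i j * (pd i (pd j ρ) x * w x)) +
      ∑ i, β i * (pd i ρ x * w x) := hT2.add hT1
  simp_rw [e1, e3]
  rw [integral_add hS (hI0.const_mul _), integral_sub hS2 hS1,
    integral_add hT (hI0.const_mul _), integral_add hT2 hT1]
  congr 1
  rw [sub_eq_add_neg]
  congr 1
  · rw [integral_finsetSum _ fun i _ => integrable_finsetSum _ fun j _ => (hI2 i j).const_mul _,
      integral_finsetSum _ fun i _ => integrable_finsetSum _ fun j _ => (hJ2 i j).const_mul _]
    refine Finset.sum_congr rfl fun i _ => ?_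
    rw [integral_finsetSum _ fun j _ => (hI2 i j).const_mul _,
      integral_finsetSum _ fun j _ => (hJ2 i j).const_mul _]
    exact Finset.sum_congr rfl fun j _ => by rw [integral_const_mul, integral_const_mul, hP2]
  · rw [integral_finsetSum _ fun i _ => (hI1 i).const_mul _,
      integral_finsetSum _ fun i _ => (hJ1 i).const_mul _, ← Finset.sum_neg_distrib]
    exact Finset.sum_congr rfl fun i _ => by
      rw [integral_const_mul, integral_const_mul, hP1, mul_neg, neg_neg]

theorem continuousOn_linOp {Ω : Set (Sp n)} (hΩ : IsOpen Ω) {w : Sp n → ℝ}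
    (hw : ContDiffOn ℝ 2 w Ω) (a : Fin n → Fin n → ℝ) (β : Fin n → ℝ) (γ : ℝ) :
    ContinuousOn (linOp a β γ w) Ω := by
  have hpw (i) : ContDiffOn ℝ 1 (pd i w) Ω :=
    contDiffOn_pd hΩ (by rw [one_add_one_eq_two]; exact hw) i
  have hppw (i j) : ContDiffOn ℝ 0 (pd j (pd i w)) Ω := contDiffOn_pd hΩ (by simpa using hpw i) j
  refine ((continuousOn_finsetSum _ fun i _ => continuousOn_finsetSum _ fun j _ =>
    (hppw i j).continuousOn.const_smul (a i j)).sub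
    (continuousOn_finsetSum _ fun i _ => (hpw i).continuousOn.const_smul (β i))).add
    (hw.continuousOn.const_smul γ)

theorem continuous_linOpAdj {ρ : Sp n → ℝ} (hρ : ContDiff ℝ 2 ρ) (a : Fin n → Fin n → ℝ)
    (β : Fin n → ℝ) (γ : ℝ) : Continuous (linOpAdj a β γ ρ) := by
  have hp (i) : ContDiff ℝ 1 (pd i ρ) := contDiff_pd (by rw [one_add_one_eq_two]; exact hρ) i
  have hpp (i j) : ContDiff ℝ 0 (pd j (pd i ρ)) := contDiff_pd (by simpa using hp i) j
  exact ((continuous_finsetSum _ fun i _ => continuous_finsetSum _ fun j _ =>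
    (hpp j i).continuous.const_smul (a i j)).add
    (continuous_finsetSum _ fun i _ => (hp i).continuous.const_smul (β i))).add
    (hρ.continuous.const_smul γ)

theorem linOpAdj_eq_zero {ρ : Sp n → ℝ} (a : Fin n → Fin n → ℝ)
    (β : Fin n → ℝ) (γ : ℝ) {x : Sp n} (hx : x ∉ tsupport ρ) : linOpAdj a β γ ρ x = 0 := by
  have h1 (i) : pd i ρ x = 0 := image_eq_zero_of_notMem_tsupport fun h =>
    hx (tsupport_pd_subset i ρ h)
  have h2 (i j) : pd i (pd j ρ) x = 0 := image_eq_zero_of_notMem_tsupport fun h =>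
    hx (tsupport_pd_subset j ρ (tsupport_pd_subset i _ h))
  simp [linOpAdj, h1, h2, image_eq_zero_of_notMem_tsupport hx]

/-- Linear differential inequalities of constant coefficients are stable under convergence in
`L¹_loc`, in the class of functions of class `C²`. -/
theorem linOp_nonneg_of_tendsto {Ω : Set (Sp n)} (hΩ : IsOpen Ω) {u : Sp n → ℝ}
    (hu : ContDiffOn ℝ 2 u Ω) {w : ℕ → Sp n → ℝ} (hw : ∀ m, ContDiffOn ℝ 2 (w m) Ω)
    (hlim : ∀ K : Set (Sp n), IsCompact K → K ⊆ Ω →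
      Tendsto (fun m => eLpNorm (fun x => w m x - u x) 1 (volume.restrict K)) atTop (𝓝 0))
    (a : Fin n → Fin n → ℝ) (β : Fin n → ℝ) (γ : ℝ)
    (hpos : ∀ m, ∀ x ∈ Ω, 0 ≤ linOp a β γ (w m) x) {x₀ : Sp n} (hx₀ : x₀ ∈ Ω) :
    0 ≤ linOp a β γ u x₀ := by
  by_contra! hneg
  have hcont := continuousOn_linOp hΩ hu a β γ
  have hmem : Ω ∩ linOp a β γ u ⁻¹' Iio 0 ∈ 𝓝 x₀ :=
    (hcont.isOpen_inter_preimage hΩ isOpen_Iio).mem_nhds ⟨hx₀, hneg⟩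
  obtain ⟨ρ, hρs, hρc, hρ, hρr, hρ1⟩ := exists_contDiff_tsupport_subset (n := 2) hmem
  have hρ : ContDiff ℝ 2 ρ := by exact_mod_cast hρ
  have hρ0 : ∀ x, 0 ≤ ρ x := fun x => (hρr (mem_range_self x)).1
  have hs : tsupport ρ ⊆ Ω := hρs.trans inter_subset_left
  have hK : IsCompact (tsupport ρ) := hρc
  have hA := continuous_linOpAdj hρ a β γ
  have hzero : ∀ g : Sp n → ℝ, ∫ x, linOpAdj a β γ ρ x * g x =
      ∫ x in tsupport ρ, linOpAdj a β γ ρ x * g x := fun g => by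
    rw [setIntegral_eq_integral_of_forall_compl_eq_zero]
    intro x hx
    rw [linOpAdj_eq_zero a β γ hx, zero_mul]
  -- the weak form of the inequality for the approximating functions
  have hwm : ∀ m, 0 ≤ ∫ x in tsupport ρ, linOpAdj a β γ ρ x * w m x := fun m => by
    rw [← hzero, ← integral_mul_linOp hΩ hρ hρc hs (hw m)]
    refine integral_nonneg fun x => ?_
    by_cases hx : x ∈ tsupport ρ
    · exact mul_nonneg (hρ0 x) (hpos m x (hs hx))
    · simp [image_eq_zero_of_notMem_tsupport hx]
  have hint : ∀ g : Sp n → ℝ, ContinuousOn g Ω →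
      Integrable (fun x => linOpAdj a β γ ρ x * g x) (volume.restrict (tsupport ρ)) :=
    fun g hg => (hA.continuousOn.mul (hg.mono hs)).integrableOn_compact hK
  obtain ⟨C, hC⟩ := hK.exists_bound_of_continuousOn hA.continuousOn
  have htend : Tendsto (fun m => ∫ x in tsupport ρ, linOpAdj a β γ ρ x * w m x) atTop
      (𝓝 (∫ x in tsupport ρ, linOpAdj a β γ ρ x * u x)) := by
    refine tendsto_integral_of_L1' _ (hint u hu.continuousOn).aestronglyMeasurable
      (Eventually.of_forall fun m => hint _ (hw m).continuousOn) ?_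
    have h0 := ENNReal.Tendsto.const_mul (a := ENNReal.ofReal C) (hlim _ hK hs)
      (Or.inr ENNReal.ofReal_ne_top)
    rw [mul_zero] at h0
    refine tendsto_of_tendsto_of_tendsto_of_le_of_le tendsto_const_nhds h0
      (fun _ => zero_le) fun m => ?_
    refine eLpNorm_le_mul_eLpNorm_of_ae_le_mul ?_ 1
    refine (ae_restrict_mem hK.measurableSet).mono fun x hx => ?_
    simp only [Pi.sub_apply]
    rw [← mul_sub, norm_mul]
    exact mul_le_mul_of_nonneg_right (hC x hx) (norm_nonneg _)
  have hlimpos := ge_of_tendsto' htend hwm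
  rw [← hzero, ← integral_mul_linOp hΩ hρ hρc hs hu] at hlimpos
  have hprod := continuous_mul_of_tsupport_subset hΩ hρ.continuous hs hcont
  have hlt : 0 < ∫ x, -(ρ x * linOp a β γ u x) := by
    refine Continuous.integral_pos_of_hasCompactSupport_nonneg_nonzero hprod.neg
      (hρc.mul_right (f' := linOp a β γ u)).neg (fun x => ?_) (x := x₀) ?_
    · by_cases hx : x ∈ tsupport ρ
      · have h1 : linOp a β γ u x < 0 := (hρs hx).2
        have h2 := mul_nonneg (hρ0 x) (neg_nonneg.mpr h1.le)
        simp only [Pi.zero_apply]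
        linarith
      · simp [image_eq_zero_of_notMem_tsupport hx]
    · rw [hρ1]; simpa using hneg.ne
  rw [integral_neg] at hlt
  linarith

/-- Continuous functions in the class `Φ^k` are nonnegative; the positivity in its definition
only holds almost everywhere. -/
theorem Phi.nonneg {k : ℕ} {Ω : Set (Sp n)} (hΩ : IsOpen Ω) {u : Sp n → ℝ} (hu : Phi k Ω u)
    (huc : ContinuousOn u Ω) {x : Sp n} (hx : x ∈ Ω) : 0 ≤ u x := by
  have ho : IsOpen (Ω ∩ u ⁻¹' Iio 0) := huc.isOpen_inter_preimage hΩ isOpen_Iio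
  have h0 : volume (Ω ∩ u ⁻¹' Iio 0) = 0 := by
    have h1 := (ae_restrict_iff' hΩ.measurableSet).mp hu.pos
    refine measure_mono_null (fun y hy => ?_) h1
    simp only [mem_compl_iff, mem_ofPred_eq, not_forall]
    exact ⟨hy.1, not_lt.mpr (le_of_lt hy.2)⟩
  rw [ho.measure_eq_zero_iff volume] at h0
  by_contra! h
  exact (h0 ▸ (show x ∈ Ω ∩ u ⁻¹' Iio 0 from ⟨hx, h⟩) : x ∈ (∅ : Set (Sp n)))

/-- A function of class `C²` in the `L¹_loc` closure of the admissible functions has admissible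
2-jets everywhere. -/
theorem Phi.jetAdm {k : ℕ} (hkn : k ≤ n) {Ω : Set (Sp n)} (hΩ : IsOpen Ω) {u : Sp n → ℝ}
    (hu : Phi k Ω u) (hu2 : ContDiffOn ℝ 2 u Ω) {x : Sp n} (hx : x ∈ Ω) :
    JetAdm k (u x) (gradient u x) (hessian u x) := by
  refine ⟨hu.nonneg hΩ hu2.continuousOn hx, fun ξ => ?_⟩
  by_contra hnot
  have : LocallyConvexSpace ℝ (Matrix (Fin n) (Fin n) ℝ) :=
    inferInstanceAs (LocallyConvexSpace ℝ (Fin n → Fin n → ℝ))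
  let P : ProperCone ℝ (Matrix (Fin n) (Fin n) ℝ) :=
    { carrier := matCone n k
      add_mem' := fun ha hb => add_mem_matCone hkn ha hb
      zero_mem' := zero_mem_matCone k
      smul_mem' := fun c _ hA => smul_mem_matCone hA c.2
      isClosed' := isClosed_matCone k }
  -- the constraint is a family of linear inequalities, one for each functional `f` that is
  -- nonnegative on the cone
  obtain ⟨f, hf, hf0⟩ := P.hyperplane_separation_point (x₀ := hessian u x -
    (inner ℝ ξ (gradient u x) - ‖ξ‖ ^ 2 / 2 * u x) • 1) hnot
  set a : Fin n → Fin n → ℝ := fun i j => f (Matrix.single i j 1)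
  set β : Fin n → ℝ := fun i => f 1 * ξ i
  set γ : ℝ := f 1 * (‖ξ‖ ^ 2 / 2)
  have key : ∀ (w : Sp n → ℝ) (y : Sp n), f (hessian w y -
      (inner ℝ ξ (gradient w y) - ‖ξ‖ ^ 2 / 2 * w y) • 1) = linOp a β γ w y := fun w y => by
    have h1 : f (hessian w y) = ∑ i, ∑ j, a i j * pd j (pd i w) y := by
      conv_lhs => rw [matrix_eq_sum_single (hessian w y), map_sum]
      refine Finset.sum_congr rfl fun i _ => ?_
      rw [map_sum]
      refine Finset.sum_congr rfl fun j _ => ?_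
      have : Matrix.single i j (hessian w y i j) = hessian w y i j • Matrix.single i j (1 : ℝ) := by
        rw [Matrix.smul_single, smul_eq_mul, mul_one]
      rw [this, map_smul, smul_eq_mul, mul_comm, hessian_apply]
    have h2 : inner ℝ ξ (gradient w y) = ∑ i, ξ i * pd i w y := by
      rw [PiLp.inner_apply]
      refine Finset.sum_congr rfl fun i _ => ?_
      rw [gradient_apply]
      simp [mul_comm]
    rw [map_sub, map_smul, h1, h2, linOp, smul_eq_mul]
    have h3 : ∑ i, β i * pd i w y = f 1 * ∑ i, ξ i * pd i w y := by
      rw [Finset.mul_sum]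
      exact Finset.sum_congr rfl fun i _ => by simp only [β]; ring
    rw [h3]
    simp only [γ]
    ring
  rw [key] at hf0
  obtain ⟨w, hw, hlim⟩ := hu.exists_seq
  have := linOp_nonneg_of_tendsto hΩ hu2 (fun m => (hw m).contDiffOn) hlim a β γ
    (fun m y hy => by
      rw [← key]
      exact hf _ (((hw m).jetAdm hkn hΩ hy).2 ξ)) hx
  linarith

/-! ### The integrand as a null Lagrangian -/

/-- The Jacobian matrix `(∂_j H_i)` of a vector field. -/
def jac (H : Sp n → Sp n) (x : Sp n) : Matrix (Fin n) (Fin n) ℝ :=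
  Matrix.of fun i j => pd j (fun y => H y i) x

theorem jac_apply {H : Sp n → Sp n} {x : Sp n} (hH : DifferentiableAt ℝ H x) (i j : Fin n) :
    jac H x i j = fderiv ℝ H x (EuclideanSpace.single j 1) i := by
  have h := ((EuclideanSpace.proj i : Sp n →L[ℝ] ℝ).hasFDerivAt.comp x hH.hasFDerivAt).fderiv
  have h' : fderiv ℝ (fun y => H y i) x =
      (EuclideanSpace.proj i : Sp n →L[ℝ] ℝ).comp (fderiv ℝ H x) := h
  simp [jac, pd, h']

theorem det_id_add_smul_fderiv {H : Sp n → Sp n} {x : Sp n} (hH : DifferentiableAt ℝ H x)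
    (s : ℝ) : (ContinuousLinearMap.id ℝ (Sp n) + s • fderiv ℝ H x).det =
      (1 + s • jac H x).det := by
  rw [ContinuousLinearMap.det,
    ← LinearMap.det_toMatrix (EuclideanSpace.basisFun (Fin n) ℝ).toBasis]
  congr 1
  ext i j
  rw [LinearMap.toMatrix_apply, Matrix.add_apply, Matrix.smul_apply, jac_apply hH]
  simp [Matrix.one_apply]

theorem continuous_jac {H : Sp n → Sp n} (hH : ContDiff ℝ 1 H) : Continuous (jac H) := by
  refine continuous_pi fun i => continuous_pi fun j => ?_
  have hc : ContDiff ℝ 1 fun y => H y i := (EuclideanSpace.proj i : Sp n →L[ℝ] ℝ).contDiff.comp hH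
  have : ContDiff ℝ 0 (pd j fun y => H y i) := contDiff_pd (by simpa using hc) j
  exact this.continuous

theorem jac_eq_zero {H : Sp n → Sp n} {x : Sp n} (hx : x ∉ tsupport H) : jac H x = 0 := by
  ext i j
  have h : x ∉ tsupport (fun y => H y i) := fun h => hx <| by
    refine closure_mono (fun y hy => ?_) h
    rw [Function.mem_support] at hy ⊢
    intro h0
    simp [h0] at hy
  have h0 : pd j (fun y => H y i) x = 0 :=
    image_eq_zero_of_notMem_tsupport fun h' => h (tsupport_pd_subset j _ h')
  simpa [jac] using h0

/-- A small compactly supported perturbation of the identity preserves the volume of any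
compact set that contains the support, because it maps this set onto itself. -/
theorem setIntegral_det_one_add_smul_jac {H : Sp n → Sp n} (hH : ContDiff ℝ 1 H)
    {B : Set (Sp n)} (hB : IsCompact B) (hs : tsupport H ⊆ B) : ∀ᶠ s in 𝓝 (0 : ℝ),
      ∫ x in B, (1 + s • jac H x).det = ∫ _ in B, (1 : ℝ) := by
  have hc : HasCompactSupport H := hB.of_isClosed_subset (isClosed_tsupport H) hs
  obtain ⟨C, hC⟩ := hH.lipschitzWith_of_hasCompactSupport hc one_ne_zero
  have hpos : ∀ᶠ s in 𝓝 (0 : ℝ), ∀ x ∈ B, 0 < (1 + s • jac H x).det := by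
    refine hB.eventually_forall_of_forall_eventually fun x _ => ?_
    have hcont : Continuous fun z : ℝ × Sp n => (1 + z.1 • jac H z.2).det :=
      Continuous.matrix_det (continuous_const.add
        (continuous_fst.smul ((continuous_jac hH).comp continuous_snd)))
    refine hcont.continuousAt.eventually (lt_mem_nhds (a := (0 : ℝ)) ?_)
    simp
  have hsmall : ∀ᶠ s in 𝓝 (0 : ℝ), ‖s‖₊ * C < 1 := by
    have hcont : Continuous fun s : ℝ => ‖s‖₊ * C := by fun_prop
    exact hcont.continuousAt.eventually (gt_mem_nhds (by simp))
  filter_upwards [hpos, hsmall] with s hs0 hs1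
  set Y : Sp n → Sp n := fun x => x + s • H x with hY
  have hlip : LipschitzWith (‖s‖₊ * C) fun x => s • H x := (lipschitzWith_smul s).comp hC
  have hinj : Function.Injective Y := fun x y hxy => by
    have h1 := hlip.dist_le_mul x y
    have h2 : x - y = s • H y - s • H x := by
      have : x + s • H x = y + s • H y := hxy
      rw [sub_eq_sub_iff_add_eq_add, this]; abel
    rw [dist_eq_norm, ← norm_neg, neg_sub, ← h2, ← dist_eq_norm] at h1
    have h3 : ((‖s‖₊ * C : NNReal) : ℝ) < 1 := by exact_mod_cast hs1
    have h4 : dist x y ≤ 0 := by nlinarith [dist_nonneg (x := x) (y := y)]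
    exact dist_le_zero.mp h4
  have hsurj : Function.Surjective Y := fun y => by
    have hcontr : ContractingWith (‖s‖₊ * C) fun x => y - s • H x := by
      refine ⟨hs1, LipschitzWith.of_dist_le_mul fun a b => ?_⟩
      rw [dist_sub_left]
      exact hlip.dist_le_mul a b
    refine ⟨hcontr.fixedPoint, ?_⟩
    have h : y - s • H hcontr.fixedPoint = hcontr.fixedPoint := hcontr.fixedPoint_isFixedPt
    exact (sub_eq_iff_eq_add.mp h).symm
  have hout : ∀ x ∉ B, Y x = x := fun x hx => by
    rw [hY]
    simp [image_eq_zero_of_notMem_tsupport fun h => hx (hs h)]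
  have himage : Y '' B = B := by
    refine Subset.antisymm ?_ fun y hy => ?_
    · rintro _ ⟨x, hx, rfl⟩
      by_contra hYx
      have := hinj (hout _ hYx)
      rw [this] at hYx
      exact hYx hx
    · obtain ⟨x, rfl⟩ := hsurj y
      refine ⟨x, ?_, rfl⟩
      by_contra hx
      rw [hout x hx] at hy
      exact hx hy
  have hd : ∀ x, HasFDerivAt Y (ContinuousLinearMap.id ℝ (Sp n) + s • fderiv ℝ H x) x := fun x =>
    (hasFDerivAt_id x).add ((hH.differentiable one_ne_zero x).hasFDerivAt.const_smul s)
  have hcv := integral_image_eq_integral_abs_det_fderiv_smul volume hB.measurableSet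
    (fun x _ => (hd x).hasFDerivWithinAt) hinj.injOn fun _ => (1 : ℝ)
  rw [himage] at hcv
  rw [hcv]
  refine setIntegral_congr_fun hB.measurableSet fun x hx => ?_
  simp only [smul_eq_mul, mul_one]
  rw [det_id_add_smul_fderiv (hH.differentiable one_ne_zero x), abs_of_pos (hs0 x hx)]

theorem integrable_sig_jac {H : Sp n → Sp n} (hH : ContDiff ℝ 1 H) (hc : HasCompactSupport H)
    {j : ℕ} (hj : j ≠ 0) : Integrable fun x => sig j (jac H x) := by
  refine Continuous.integrable_of_hasCompactSupport ((continuous_sig j).comp (continuous_jac hH))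
    (HasCompactSupport.intro hc fun x hx => ?_)
  rw [jac_eq_zero hx, sig_zero_matrix hj]

/-- The elementary symmetric functions of the Jacobian matrix are null Lagrangians. -/
theorem integral_sig_jac {H : Sp n → Sp n} (hH : ContDiff ℝ 1 H) (hc : HasCompactSupport H)
    {j : ℕ} (hj : j ≠ 0) : ∫ x, sig j (jac H x) = 0 := by
  have hK : IsCompact (tsupport H) := hc
  -- `∫ det (1 + s DH)` does not depend on small `s`; the coefficients of this polynomial in `s` are
  -- recovered from its values at the points `s i`
  obtain ⟨δ, hδ, hball⟩ := Metric.eventually_nhds_iff.mp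
    (setIntegral_det_one_add_smul_jac hH hK Subset.rfl)
  set s : ℕ → ℝ := fun i => δ / (i + 2) with hs
  have hsinj : Function.Injective s := fun i i' h => by
    have h' : δ / (i + 2) = δ / (i' + 2) := h
    rw [div_eq_div_iff (by positivity) (by positivity)] at h'
    exact_mod_cast (add_right_cancel (mul_left_cancel₀ hδ.ne' h')).symm
  have hdet : ∀ i, ∫ x in tsupport H, (1 + s i • jac H x).det = ∫ _ in tsupport H, (1 : ℝ) :=
    fun i => hball (by
      have h2 : (0 : ℝ) ≤ i := i.cast_nonneg
      rw [Real.dist_0_eq_abs, hs, abs_of_pos (by positivity)]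
      exact div_lt_self hδ (by linarith))
  obtain ⟨c, hcs⟩ := exists_coeff_eq_sum_eval n j hsinj
  have hsum : ∑ i ∈ Finset.range (n + 1), c i = 0 := by
    have := hcs 1 (by simp)
    simpa [Polynomial.coeff_one, hj] using this.symm
  have hint : ∀ i, IntegrableOn (fun x => (1 + s i • jac H x).det) (tsupport H) := fun i =>
    (Continuous.matrix_det (continuous_const.add
      ((continuous_jac hH).const_smul (s i)))).continuousOn.integrableOn_compact hK
  rw [← setIntegral_eq_integral_of_forall_compl_eq_zero (s := tsupport H) fun x hx => by
    rw [jac_eq_zero hx, sig_zero_matrix hj]]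
  have he : ∀ x, sig j (jac H x) =
      ∑ i ∈ Finset.range (n + 1), c i * (1 + s i • jac H x).det := fun x => by
    rw [sig, hcs _ (natDegree_pencil_le _)]
    simp_rw [eval_pencil]
  simp_rw [he]
  rw [integral_finsetSum _ fun i _ => (hint i).const_mul _]
  simp_rw [integral_const_mul, hdet]
  rw [← Finset.sum_mul, hsum, zero_mul]

theorem tau_smul (m : ℕ) (c : ℝ) (A : Matrix (Fin n) (Fin n) ℝ) (a b : Fin n → ℝ) :
    tau m (c • A) a b = c ^ m * tau m A a b := by
  have : tauPoly (c • A) a b = (tauPoly A a b).comp (Polynomial.C c * Polynomial.X) :=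
    Polynomial.funext fun s => by
      rw [Polynomial.eval_comp, eval_tauPoly, eval_tauPoly, smul_smul, Polynomial.eval_mul,
        Polynomial.eval_C, Polynomial.eval_X, mul_comm s]
  rw [tau, this, Polynomial.comp_C_mul_X_coeff, mul_comm, tau]

theorem contDiff_gradient {w : Sp n → ℝ} (hw : ContDiff ℝ 2 w) : ContDiff ℝ 1 (gradient w) :=
  (LinearIsometryEquiv.contDiff _).comp (hw.fderiv_right (by rw [one_add_one_eq_two]))

theorem hasCompactSupport_gradient {w : Sp n → ℝ} (hc : HasCompactSupport w) :
    HasCompactSupport (gradient w) :=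
  (hc.fderiv ℝ).comp_left (map_zero _)

open Polynomial in
/-- The first-order term in `s` of `σ_{m+1}((1 + s f) r + s p ⊗ g)`, expressed through the values
at finitely many integers `s`. -/
theorem exists_mul_sig_add_tau_eq_sum (m : ℕ) : ∃ c : ℕ → ℝ,
    ∀ (f : ℝ) (r : Matrix (Fin n) (Fin n) ℝ) (p g : Fin n → ℝ),
      (m + 1) * f * sig (m + 1) r + tau m r p g = ∑ i ∈ Finset.range (m + 1 + 1),
        c i * sig (m + 1) ((1 + i * f) • r + (i : ℝ) • vecMulVec p g) := by
  obtain ⟨c, hc⟩ := exists_coeff_eq_sum_eval (m + 1) 1 (Nat.cast_injective (R := ℝ))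
  refine ⟨c, fun f r p g => ?_⟩
  have hdeg : ((1 + C f * X) ^ (m + 1) * C (sig (m + 1) r) +
      X * ((1 + C f * X) ^ m * C (tau m r p g))).natDegree ≤ m + 1 := by
    have h1 : (1 + C f * X : ℝ[X]).natDegree ≤ 1 := by compute_degree
    have h2 : ∀ N : ℕ, ((1 + C f * X : ℝ[X]) ^ N).natDegree ≤ N := fun N =>
      (natDegree_pow_le_of_le N h1).trans (by simp)
    refine natDegree_add_le_of_degree_le ?_ ?_
    · exact (natDegree_mul_C_le _ _).trans (h2 _)
    · exact (natDegree_mul_le_of_le natDegree_X_le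
        ((natDegree_mul_C_le _ _).trans (h2 m))).trans (by omega)
  have h := hc _ hdeg
  rw [coeff_add, coeff_mul_C, coeff_one_add_C_mul_X_pow, coeff_X_mul, coeff_mul_C,
    coeff_one_add_C_mul_X_pow] at h
  simp only [Nat.choose_one_right, Nat.choose_zero_right, pow_one, pow_zero, Nat.cast_add,
    Nat.cast_one, mul_one, one_mul] at h
  rw [h]
  refine Finset.sum_congr rfl fun i _ => ?_
  rw [sig_add_vecMulVec, sig_smul, tau_smul]
  simp only [eval_add, eval_mul, eval_pow, eval_one, eval_C, eval_X]
  ring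

theorem jac_smul_gradient {w f : Sp n → ℝ} (hw : ContDiff ℝ 2 w) (hf : ContDiff ℝ 1 f) (s : ℝ)
    (x : Sp n) : jac (fun y => (1 + s * f y) • gradient w y) x = (1 + s * f x) • hessian w x +
      s • vecMulVec (fun i => pd i w x) (fun i => pd i f x) := by
  ext i j
  have hpw : ContDiff ℝ 1 (pd i w) := contDiff_pd (by rw [one_add_one_eq_two]; exact hw) i
  have h0 : (fun y => ((1 + s * f y) • gradient w y) i) = fun y => (1 + s * f y) * pd i w y := by
    funext y; simp [gradient_apply]
  have h1 : HasFDerivAt (fun y => (1 + s * f y) * pd i w y)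
      ((1 + s * f x) • fderiv ℝ (pd i w) x + pd i w x • (s • fderiv ℝ f x)) x :=
    (((hf.differentiable one_ne_zero x).hasFDerivAt.const_mul s).const_add 1).mul
      (hpw.differentiable one_ne_zero x).hasFDerivAt
  have h2 : pd j (fun y => (1 + s * f y) * pd i w y) x =
      (1 + s * f x) * pd j (pd i w) x + pd i w x * (s * pd j f x) := by
    rw [pd, h1.fderiv]
    rfl
  simp only [jac, of_apply, h0, h2, Matrix.add_apply, Matrix.smul_apply, hessian_apply,
    vecMulVec_apply, smul_eq_mul]
  ring

/-- The divergence identity for the flux `f T_m(D²w) ∇w` in integrated form. It is the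
first-order term in `s` of the null Lagrangian identity for the field `(1 + s f) ∇w`. -/
theorem integral_mul_sig_hessian_add_tau {w f : Sp n → ℝ} (hw : ContDiff ℝ 2 w)
    (hc : HasCompactSupport w) (hf : ContDiff ℝ 1 f) (m : ℕ) :
    (Integrable fun x => (m + 1) * f x * sig (m + 1) (hessian w x) +
      tau m (hessian w x) (fun i => pd i w x) (fun i => pd i f x)) ∧
    ∫ x, ((m + 1) * f x * sig (m + 1) (hessian w x) +
      tau m (hessian w x) (fun i => pd i w x) (fun i => pd i f x)) = 0 := by
  have hHd : ∀ s : ℝ, ContDiff ℝ 1 fun y => (1 + s * f y) • gradient w y := fun s =>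
    (contDiff_const.add (contDiff_const.mul hf)).smul (contDiff_gradient hw)
  have hHc : ∀ s : ℝ, HasCompactSupport fun y => (1 + s * f y) • gradient w y := fun s =>
    (hasCompactSupport_gradient hc).smul_left (f := fun y => 1 + s * f y)
  obtain ⟨c, hcs⟩ := exists_mul_sig_add_tau_eq_sum (n := n) m
  have hsum : ∀ x, (m + 1) * f x * sig (m + 1) (hessian w x) +
      tau m (hessian w x) (fun i => pd i w x) (fun i => pd i f x) =
      ∑ i ∈ Finset.range (m + 1 + 1),
        c i * sig (m + 1) (jac (fun y => (1 + (i : ℝ) * f y) • gradient w y) x) := fun x => by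
    rw [hcs]
    exact Finset.sum_congr rfl fun i _ => by rw [jac_smul_gradient hw hf]
  have hint : ∀ i ∈ Finset.range (m + 1 + 1), Integrable fun x =>
      c i * sig (m + 1) (jac (fun y => (1 + (i : ℝ) * f y) • gradient w y) x) := fun i _ =>
    (integrable_sig_jac (hHd i) (hHc i) (Nat.succ_ne_zero m)).const_mul _
  simp only [hsum]
  refine ⟨integrable_finsetSum _ hint, ?_⟩
  rw [integral_finsetSum _ hint]
  refine Finset.sum_eq_zero fun i _ => ?_
  rw [integral_const_mul, integral_sig_jac (hHd i) (hHc i) (Nat.succ_ne_zero m), mul_zero]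

theorem norm_gradient_sq (w : Sp n → ℝ) (x : Sp n) : ‖gradient w x‖ ^ 2 = ∑ i, pd i w x ^ 2 := by
  rw [EuclideanSpace.real_norm_sq_eq]
  simp_rw [gradient_apply]

theorem rpow_add_nat_of_nonneg {w α : ℝ} (hw : 0 ≤ w) (hα : 0 ≤ α) (m : ℕ) :
    w ^ (α + m) = w ^ α * w ^ m := by
  rw [Real.rpow_add_of_nonneg hw hα m.cast_nonneg, Real.rpow_natCast]

/-- The integrand, with elementary symmetric functions read off from `det (1 + X A)`. -/
def jetPsi (k : ℕ) (α w : ℝ) (p : Sp n) (r : Matrix (Fin n) (Fin n) ℝ) : ℝ :=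
  w ^ α * Psi k α w (‖p‖ ^ 2) r

/-- The integrand is a divergence: pointwise it is the sum of the divergences of the fluxes
`d_m w ^ (α + m + 1) |∇w| ^ (2 (k - 1 - m)) T_m(D²w) ∇w`, `m < k`. -/
theorem jetPsi_eq_sum {k : ℕ} (hk : 1 ≤ k) (hkn : k ≤ n) {α : ℝ} (hα : 0 ≤ α) {w : Sp n → ℝ}
    (hw : ContDiff ℝ 2 w) {x : Sp n} (hw0 : 0 ≤ w x) :
    jetPsi k α (w x) (gradient w x) (hessian w x) = ∑ m ∈ Finset.range k,
      (1 / 2) ^ (k - 1 - m) * fallBinom (α + k) (k - 1 - m) *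
      ((m + 1) * (w x ^ (α + (m + 1 : ℕ)) * (∑ i, pd i w x ^ 2) ^ (k - 1 - m)) *
        sig (m + 1) (hessian w x) + tau m (hessian w x) (fun i => pd i w x) (fun i => pd i
          (fun y => w y ^ (α + (m + 1 : ℕ)) * (∑ i, pd i w y ^ 2) ^ (k - 1 - m)) x)) := by
  set r := hessian w x with hr
  set p : Fin n → ℝ := fun i => pd i w x with hp
  set q : Sp n → ℝ := fun y => ∑ i, pd i w y ^ 2 with hq
  have hsym : rᵀ = r := hessian_transpose isOpen_univ hw.contDiffOn (mem_univ x)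
  have hpw (i) : ContDiff ℝ 1 (pd i w) := contDiff_pd (by rw [one_add_one_eq_two]; exact hw) i
  have hwd : HasFDerivAt w (fderiv ℝ w x) x := (hw.differentiable two_ne_zero x).hasFDerivAt
  have hqd : HasFDerivAt q (∑ i, (2 * pd i w x) • fderiv ℝ (pd i w) x) x := by
    refine HasFDerivAt.fun_sum fun i _ => ?_
    simpa using ((hpw i).differentiable one_ne_zero x).hasFDerivAt.pow 2
  -- the gradient of the scalar factors
  have hgrad : ∀ m B : ℕ, (fun i => pd i (fun y => w y ^ (α + (m + 1 : ℕ)) * q y ^ B) x) =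
      ((α + (m + 1 : ℕ)) * (w x ^ α * w x ^ m) * q x ^ B) • p +
        (2 * B * (w x ^ α * w x ^ (m + 1)) * q x ^ (B - 1)) • (r *ᵥ p) := fun m B => by
    have h1 : (1 : ℝ) ≤ α + (m + 1 : ℕ) := by
      push_cast; linarith [(m.cast_nonneg : (0 : ℝ) ≤ m)]
    have h2 := (hwd.rpow_const (p := α + (m + 1 : ℕ)) (Or.inr h1)).mul (hqd.pow B)
    have h3 : α + ((m + 1 : ℕ) : ℝ) - 1 = α + m := by push_cast; ring
    rw [h3, rpow_add_nat_of_nonneg hw0 hα, rpow_add_nat_of_nonneg hw0 hα] at h2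
    funext j
    have h5 : pd j (fun y => w y ^ (α + (m + 1 : ℕ)) * q y ^ B) x = _ :=
      congrArg (fun L : Sp n →L[ℝ] ℝ => L (EuclideanSpace.single j 1)) h2.fderiv
    have h4 : (r *ᵥ p) j = ∑ i, pd i w x * pd j (pd i w) x := by
      rw [← hsym, mulVec, dotProduct]
      exact Finset.sum_congr rfl fun i _ => by rw [transpose_apply, hr, hessian_apply, mul_comm]
    rw [h5, Pi.add_apply, Pi.smul_apply, Pi.smul_apply, h4]
    have h6 : (∑ i, (2 * pd i w x) • fderiv ℝ (pd i w) x) (EuclideanSpace.single j 1) =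
        2 * ∑ i, pd i w x * pd j (pd i w) x := by
      rw [_root_.sum_apply, Finset.mul_sum]
      refine Finset.sum_congr rfl fun i _ => ?_
      rw [_root_.smul_apply, smul_eq_mul, mul_assoc]
      rfl
    have h7 : fderiv ℝ w x (EuclideanSpace.single j 1) = p j := rfl
    simp only [_root_.add_apply, _root_.smul_apply, h6, h7, smul_eq_mul,
      nsmul_eq_mul]
    ring
  -- the terms `w ^ (α + m) |∇w| ^ (2 (k - 1 - m)) T_m(∇w, ∇w)` telescope
  set G : ℕ → ℝ := fun m => 2 * (k - m : ℕ) * ((1 / 2) ^ (k - m) * fallBinom (α + k) (k - m)) *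
    (w x ^ α * w x ^ m * q x ^ (k - 1 - m) * tau m r p p) with hG
  have hcoef : ∀ m < k, 2 * ((k - m : ℕ) : ℝ) * ((1 / 2) ^ (k - m) * fallBinom (α + k) (k - m)) =
      (1 / 2) ^ (k - 1 - m) * fallBinom (α + k) (k - 1 - m) * (α + (m + 1 : ℕ)) := fun m hm => by
    obtain ⟨N, hN⟩ := Nat.exists_eq_add_of_lt hm
    have h1 : k - m = N + 1 := by omega
    have h2 : k - 1 - m = N := by omega
    have h3 := fallBinom_succ (α + k) N
    rw [h1, h2, pow_succ]
    have h4 : (k : ℝ) = m + N + 1 := by exact_mod_cast hN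
    push_cast
    have h5 : α + k - N = α + (m + 1) := by rw [h4]; ring
    rw [h5] at h3
    linear_combination (1 / 2 : ℝ) ^ N * h3
  have hterm : ∀ m ∈ Finset.range k, (1 / 2) ^ (k - 1 - m) * fallBinom (α + k) (k - 1 - m) *
      ((m + 1) * (w x ^ (α + (m + 1 : ℕ)) * q x ^ (k - 1 - m)) * sig (m + 1) r +
        tau m r p (fun i => pd i (fun y => w y ^ (α + (m + 1 : ℕ)) * q y ^ (k - 1 - m)) x)) =
      w x ^ α * (cCoeff k α (m + 1) * w x ^ (m + 1) * q x ^ (k - (m + 1)) * sig (m + 1) r) +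
        (G m - G (m + 1)) := fun m hm => by
    have hm := Finset.mem_range.mp hm
    have ht := tau_succ hsym m p p
    have hpp : p ⬝ᵥ p = q x := by
      simp only [dotProduct, hq, hp]
      exact Finset.sum_congr rfl fun i _ => by ring
    rw [hpp] at ht
    rw [hgrad, tau_add_right, tau_smul_right, tau_smul_right, hG]
    simp only
    rw [hcoef m hm, cCoeff, rpow_add_nat_of_nonneg hw0 hα]
    have e1 : k - (m + 1) = k - 1 - m := by omega
    have e2 : k - 1 - (m + 1) = k - 1 - m - 1 := by omega
    have e3 : (k : ℝ) = m + 1 + (k - 1 - m : ℕ) := by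
      have : k = m + 1 + (k - 1 - m) := by omega
      exact_mod_cast this
    rw [e1, e2]
    set B := k - 1 - m with hBdef
    have ht' : tau m r p (r *ᵥ p) = q x * sig (m + 1) r - tau (m + 1) r p p := by linarith
    have hB : (B : ℝ) * q x ^ (B - 1) * q x = B * q x ^ B := by
      cases B with
      | zero => simp
      | succ B => rw [Nat.add_sub_cancel, mul_assoc, ← pow_succ]
    rw [ht']
    generalize hD : (1 / 2 : ℝ) ^ B * fallBinom (α + k) B = D
    rw [e3]
    linear_combination (2 * D * w x ^ α * w x ^ (m + 1) * sig (m + 1) r) * hB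
  rw [Finset.sum_congr rfl hterm, Finset.sum_add_distrib, Finset.sum_range_sub', jetPsi,
    Psi_eq_sum hk hkn hα, Finset.sum_range_succ', mul_add, Finset.mul_sum, norm_gradient_sq]
  congr 1
  have hGk : G k = 0 := by simp [hG]
  have hG0 : G 0 = w x ^ α * (cCoeff k α 0 * w x ^ 0 * q x ^ (k - 0) * sig 0 r) := by
    rw [hG, cCoeff, sig_zero]
    simp only [Nat.sub_zero, pow_zero]
    rw [tau_zero hsym]
    have hpp : p ⬝ᵥ p = q x := by
      simp only [dotProduct, hq, hp]
      exact Finset.sum_congr rfl fun i _ => by ring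
    have hqk : q x ^ k = q x ^ (k - 1) * q x := by rw [← pow_succ]; congr 1; omega
    rw [hpp, hqk]
    ring
  rw [hGk, sub_zero, hG0]

/-- The integral of the integrand over `ℝⁿ` vanishes for nonnegative `C²` functions of compact
support. -/
theorem integral_jetPsi_eq_zero {k : ℕ} (hk : 1 ≤ k) (hkn : k ≤ n) {α : ℝ} (hα : 0 ≤ α)
    {w : Sp n → ℝ} (hw : ContDiff ℝ 2 w) (hc : HasCompactSupport w) (hw0 : ∀ x, 0 ≤ w x) :
    (Integrable fun x => jetPsi k α (w x) (gradient w x) (hessian w x)) ∧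
    ∫ x, jetPsi k α (w x) (gradient w x) (hessian w x) = 0 := by
  have hpw (i) : ContDiff ℝ 1 (pd i w) := contDiff_pd (by rw [one_add_one_eq_two]; exact hw) i
  have hf : ∀ m B : ℕ, ContDiff ℝ 1 fun y => w y ^ (α + (m + 1 : ℕ)) * (∑ i, pd i w y ^ 2) ^ B :=
    fun m B => by
      refine ContDiff.mul ?_ ((ContDiff.sum fun i _ => (hpw i).pow 2).pow B)
      have h1 : ((1 : ℕ) : ℝ) ≤ α + (m + 1 : ℕ) := by
        push_cast; linarith [(m.cast_nonneg : (0 : ℝ) ≤ m)]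
      exact_mod_cast (hw.of_le (m := ((1 : ℕ) : WithTop ℕ∞)) (by norm_num)).rpow_const_of_le h1
  have h := fun m B => integral_mul_sig_hessian_add_tau hw hc (hf m B) m
  simp_rw [fun x => jetPsi_eq_sum hk hkn hα hw (hw0 x)]
  have hint : ∀ m ∈ Finset.range k, _ := fun m _ => (h m (k - 1 - m)).1.const_mul
    ((1 / 2) ^ (k - 1 - m) * fallBinom (α + k) (k - 1 - m))
  refine ⟨integrable_finsetSum _ hint, ?_⟩
  rw [integral_finsetSum _ hint]
  refine Finset.sum_eq_zero fun m _ => ?_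
  rw [integral_const_mul, (h m (k - 1 - m)).2, mul_zero]

/-! ### A smooth convex ramp -/

/-- A smooth step function: zero on `(-∞, 1]`, one on `[2, ∞)`. It is the derivative of `ramp`. -/
def rampDeriv (s : ℝ) : ℝ := Real.smoothTransition (s - 1)

/-- The second derivative of `ramp`. -/
def rampDeriv2 (s : ℝ) : ℝ := deriv Real.smoothTransition (s - 1)

/-- A smooth convex function on the line, zero on `(-∞, 1]` and of slope one on `[2, ∞)`. -/
def ramp (s : ℝ) : ℝ := ∫ t in (1 : ℝ)..s, rampDeriv t

theorem continuous_rampDeriv : Continuous rampDeriv :=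
  Real.smoothTransition.continuous.comp (by fun_prop)

theorem hasDerivAt_rampDeriv (s : ℝ) : HasDerivAt rampDeriv (rampDeriv2 s) s := by
  have h := (Real.smoothTransition.contDiff (n := 1)).differentiable one_ne_zero (s - 1)
  have h' := h.hasDerivAt.comp s ((hasDerivAt_id s).sub_const 1)
  rw [mul_one] at h'
  exact h'

theorem hasDerivAt_ramp (s : ℝ) : HasDerivAt ramp (rampDeriv s) s :=
  (continuous_rampDeriv.integral_hasStrictDerivAt 1 s).hasDerivAt

theorem continuous_rampDeriv2 : Continuous rampDeriv2 :=
  ((Real.smoothTransition.contDiff (n := 1)).continuous_deriv le_rfl).comp (by fun_prop)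

theorem contDiff_ramp : ContDiff ℝ 2 ramp := by
  have h1 : deriv ramp = rampDeriv := funext fun s => (hasDerivAt_ramp s).deriv
  have h2 : ContDiff ℝ 1 rampDeriv :=
    (Real.smoothTransition.contDiff (n := 1)).comp (contDiff_id.sub contDiff_const)
  rw [← one_add_one_eq_two, contDiff_succ_iff_deriv, h1]
  exact ⟨fun s => (hasDerivAt_ramp s).differentiableAt, by simp, h2⟩

theorem continuous_ramp : Continuous ramp := contDiff_ramp.continuous

theorem rampDeriv_nonneg (s : ℝ) : 0 ≤ rampDeriv s := Real.smoothTransition.nonneg _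

theorem rampDeriv_le_one (s : ℝ) : rampDeriv s ≤ 1 := Real.smoothTransition.le_one _

theorem rampDeriv_of_le {s : ℝ} (hs : s ≤ 1) : rampDeriv s = 0 :=
  Real.smoothTransition.zero_of_nonpos (by linarith)

theorem rampDeriv_of_ge {s : ℝ} (hs : 2 ≤ s) : rampDeriv s = 1 :=
  Real.smoothTransition.one_of_one_le (by linarith)

theorem rampDeriv2_nonneg (s : ℝ) : 0 ≤ rampDeriv2 s := Real.smoothTransition.monotone.deriv_nonneg

theorem rampDeriv2_of_lt {s : ℝ} (hs : s < 1) : rampDeriv2 s = 0 := by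
  have h : rampDeriv =ᶠ[𝓝 s] fun _ => 0 :=
    (gt_mem_nhds hs).mono fun t ht => rampDeriv_of_le (le_of_lt ht)
  rw [← (hasDerivAt_rampDeriv s).deriv, h.deriv_eq, deriv_const]

theorem rampDeriv2_of_gt {s : ℝ} (hs : 2 < s) : rampDeriv2 s = 0 := by
  have h : rampDeriv =ᶠ[𝓝 s] fun _ => 1 :=
    (lt_mem_nhds hs).mono fun t ht => rampDeriv_of_ge (le_of_lt ht)
  rw [← (hasDerivAt_rampDeriv s).deriv, h.deriv_eq, deriv_const]

theorem ramp_of_le {s : ℝ} (hs : s ≤ 1) : ramp s = 0 := by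
  rw [ramp, intervalIntegral.integral_congr (g := fun _ => 0), intervalIntegral.integral_zero]
  intro t ht
  rw [uIcc_of_ge hs] at ht
  exact rampDeriv_of_le ht.2

theorem ramp_nonneg (s : ℝ) : 0 ≤ ramp s := by
  rcases le_total s 1 with hs | hs
  · rw [ramp_of_le hs]
  · exact intervalIntegral.integral_nonneg hs fun t _ => rampDeriv_nonneg t

theorem ramp_le {s : ℝ} (h0 : 0 ≤ s) : ramp s ≤ s := by
  rcases le_total s 1 with hs | hs
  · rw [ramp_of_le hs]; exact h0
  · have h := intervalIntegral.integral_mono_on (μ := volume) hs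
      (continuous_rampDeriv.intervalIntegrable 1 s) (continuous_const.intervalIntegrable 1 s)
      fun t _ => rampDeriv_le_one t
    rw [intervalIntegral.integral_const, smul_eq_mul, mul_one] at h
    have h' : ramp s ≤ s - 1 := h
    linarith

theorem le_ramp_add_two (s : ℝ) : s ≤ ramp s + 2 := by
  rcases le_total s 2 with hs | hs
  · linarith [ramp_nonneg s]
  · have h1 : ramp s = ramp 2 + ∫ t in (2 : ℝ)..s, rampDeriv t :=
      (intervalIntegral.integral_add_adjacent_intervals
        (continuous_rampDeriv.intervalIntegrable 1 2)
        (continuous_rampDeriv.intervalIntegrable 2 s)).symm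
    have h2 : ∫ t in (2 : ℝ)..s, rampDeriv t = s - 2 := by
      rw [intervalIntegral.integral_congr (g := fun _ => 1), intervalIntegral.integral_const,
        smul_eq_mul, mul_one]
      intro t ht
      rw [uIcc_of_le hs] at ht
      exact rampDeriv_of_ge ht.1
    linarith [ramp_nonneg 2]

theorem exists_rampDeriv2_mul_le :
    ∃ C : ℝ, ∀ s, |rampDeriv2 s * (s * rampDeriv s - ramp s)| ≤ C := by
  have hcont : Continuous fun s => rampDeriv2 s * (s * rampDeriv s - ramp s) :=
    continuous_rampDeriv2.mul ((continuous_id.mul continuous_rampDeriv).sub continuous_ramp)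
  obtain ⟨C, hC⟩ := (isCompact_Icc (a := (1 : ℝ)) (b := 2)).exists_bound_of_continuousOn
    hcont.continuousOn
  refine ⟨C, fun s => ?_⟩
  by_cases hs : s ∈ Icc (1 : ℝ) 2
  · exact hC s hs
  · have hC0 : 0 ≤ C := (norm_nonneg _).trans (hC 1 ⟨le_rfl, by norm_num⟩)
    have h0 : rampDeriv2 s = 0 := by
      rcases lt_or_ge s 1 with h | h
      · exact rampDeriv2_of_lt h
      · exact rampDeriv2_of_gt (not_le.mp fun h' => hs ⟨h, h'⟩)
    simpa [h0] using hC0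

/-! ### Perturbations of compact support -/

open scoped Manifold ContDiff in
theorem exists_contDiff_cutoff {K Ω : Set (Sp n)} (hK : IsCompact K) (hΩ : IsOpen Ω)
    (hKΩ : K ⊆ Ω) : ∃ χ : Sp n → ℝ, ContDiff ℝ 2 χ ∧ HasCompactSupport χ ∧ tsupport χ ⊆ Ω ∧
      (∀ x, 0 ≤ χ x) ∧ ∀ x ∈ K, ∀ᶠ y in 𝓝 x, χ y = 1 := by
  obtain ⟨L, hL, hKL, hLΩ⟩ := exists_compact_between hK hΩ hKΩ
  obtain ⟨χ, h1, h0, h01⟩ := exists_contMDiffMap_one_nhds_of_subset_interior (n := 2)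
    𝓘(ℝ, Sp n) hK.isClosed hKL
  have hs : tsupport χ ⊆ L := closure_minimal
    (fun x hx => by_contra fun h => hx (h0 x h)) hL.isClosed
  refine ⟨χ, contMDiff_iff_contDiff.mp χ.contMDiff, hL.of_isClosed_subset (isClosed_tsupport _) hs,
    hs.trans hLΩ, fun x => (h01 x).1, fun x hx => ?_⟩
  exact h1.filter_mono (nhds_le_nhdsSet hx)

/-- The integrand evaluated along the 2-jet of a function. -/
def jet (k : ℕ) (α : ℝ) (w : Sp n → ℝ) (x : Sp n) : ℝ :=
  jetPsi k α (w x) (gradient w x) (hessian w x)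

theorem jet_congr {k : ℕ} {α : ℝ} {w w' : Sp n → ℝ} {x : Sp n} (h : w =ᶠ[𝓝 x] w') :
    jet k α w x = jet k α w' x := by
  have h1 : gradient w x = gradient w' x := by rw [gradient, gradient, h.fderiv_eq]
  have h2 : hessian w x = hessian w' x := by
    ext i j
    have : pd i w =ᶠ[𝓝 x] pd i w' := h.fderiv.mono fun y hy => by rw [pd, pd, hy]
    rw [hessian_apply, hessian_apply, pd, pd, this.fderiv_eq]
  rw [jet, jet, h1, h2, h.eq_of_nhds]

theorem psi_eq_jet {k : ℕ} {α : ℝ} {Ω : Set (Sp n)} (hΩ : IsOpen Ω)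
    {w : Sp n → ℝ} (hw : ContDiffOn ℝ 2 w Ω) {x : Sp n} (hx : x ∈ Ω) :
    psi k α w x = jet k α w x := by
  have hs : (schouten w x)ᵀ = schouten w x := by
    rw [schouten, transpose_sub, transpose_smul, transpose_smul, transpose_one,
      hessian_transpose hΩ hw hx]
  have hH : (schouten w x).IsHermitian := by
    rw [IsHermitian, conjTranspose_eq_transpose_of_trivial, hs]
  rw [psi, jet, jetPsi, Psi, Finset.mul_sum]
  refine Finset.sum_congr rfl fun l _ => ?_
  rw [S, sigma_eigenvalues _ hH, schouten, pow_mul]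
  ring

theorem contDiff_mul_of_tsupport_subset {Ω : Set (Sp n)} (hΩ : IsOpen Ω) {χ w : Sp n → ℝ}
    (hχ : ContDiff ℝ 2 χ) (hs : tsupport χ ⊆ Ω) (hw : ContDiffOn ℝ 2 w Ω) :
    ContDiff ℝ 2 fun x => χ x * w x := by
  refine contDiff_iff_contDiffAt.mpr fun x => ?_
  by_cases hx : x ∈ tsupport χ
  · exact hχ.contDiffAt.mul (hw.contDiffAt (hΩ.mem_nhds (hs hx)))
  · refine (contDiffAt_const (c := (0 : ℝ))).congr_of_eventuallyEq ?_
    filter_upwards [notMem_tsupport_iff_eventuallyEq.mp hx] with y hy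
    rw [hy, Pi.zero_apply, zero_mul]

/-- The integral of the integrand is not changed by perturbations of compact support. -/
theorem integral_jet_sub_jet {k : ℕ} (hk : 1 ≤ k) (hkn : k ≤ n) {α : ℝ} (hα : 0 ≤ α)
    {Ω K : Set (Sp n)} (hΩ : IsOpen Ω) (hK : IsCompact K) (hKΩ : K ⊆ Ω) {v w : Sp n → ℝ}
    (hv : ContDiffOn ℝ 2 v Ω) (hw : ContDiffOn ℝ 2 w Ω) (hv0 : ∀ x ∈ Ω, 0 ≤ v x)
    (hw0 : ∀ x ∈ Ω, 0 ≤ w x) (h : ∀ x ∈ Ω, x ∉ K → w =ᶠ[𝓝 x] v) :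
    IntegrableOn (fun x => jet k α w x - jet k α v x) Ω ∧
      ∫ x in Ω, (jet k α w x - jet k α v x) = 0 := by
  -- `χ w` and `χ v` have integrals zero, and their jets differ only on `K`, where `χ = 1`
  obtain ⟨χ, hχ, hχc, hχs, hχ0, hχ1⟩ := exists_contDiff_cutoff hK hΩ hKΩ
  have hnn : ∀ g : Sp n → ℝ, (∀ x ∈ Ω, 0 ≤ g x) → ∀ x, 0 ≤ χ x * g x := fun g hg x => by
    by_cases hx : x ∈ tsupport χ
    · exact mul_nonneg (hχ0 x) (hg x (hχs hx))
    · rw [image_eq_zero_of_notMem_tsupport hx, zero_mul]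
  obtain ⟨hIw, hw1⟩ : Integrable (fun x => jet k α (fun y => χ y * w y) x) volume ∧
      ∫ x, jet k α (fun y => χ y * w y) x = 0 := integral_jetPsi_eq_zero hk hkn hα
    (contDiff_mul_of_tsupport_subset hΩ hχ hχs hw) (hχc.mul_right (f' := w)) (hnn w hw0)
  obtain ⟨hIv, hv1⟩ : Integrable (fun x => jet k α (fun y => χ y * v y) x) volume ∧
      ∫ x, jet k α (fun y => χ y * v y) x = 0 := integral_jetPsi_eq_zero hk hkn hα
    (contDiff_mul_of_tsupport_subset hΩ hχ hχs hv) (hχc.mul_right (f' := v)) (hnn v hv0)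
  have hzero : ∀ x ∉ K, (x ∈ Ω → w =ᶠ[𝓝 x] v) →
      (fun y => χ y * w y) =ᶠ[𝓝 x] fun y => χ y * v y := fun x hxK hx => by
    by_cases hxΩ : x ∈ Ω
    · filter_upwards [hx hxΩ] with y hy
      rw [hy]
    · filter_upwards [notMem_tsupport_iff_eventuallyEq.mp fun h' => hxΩ (hχs h')] with y hy
      rw [hy, Pi.zero_apply, zero_mul, zero_mul]
  have heq : (Ω.indicator fun x => jet k α w x - jet k α v x) = fun x =>
      jet k α (fun y => χ y * w y) x - jet k α (fun y => χ y * v y) x := by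
    funext x
    by_cases hxK : x ∈ K
    · have h1 : ∀ g : Sp n → ℝ, g =ᶠ[𝓝 x] fun y => χ y * g y := fun g => by
        filter_upwards [hχ1 x hxK] with y hy
        rw [hy, one_mul]
      rw [indicator_of_mem (hKΩ hxK), jet_congr (h1 w), jet_congr (h1 v)]
    · have h1 := jet_congr (k := k) (α := α) (hzero x hxK fun hxΩ => h x hxΩ hxK)
      rw [h1, sub_self]
      by_cases hxΩ : x ∈ Ω
      · rw [indicator_of_mem hxΩ, jet_congr (h x hxΩ hxK), sub_self]
      · rw [indicator_of_notMem hxΩ]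
  constructor
  · rw [← integrable_indicator_iff hΩ.measurableSet, heq]
    exact hIw.sub hIv
  · rw [← integral_indicator hΩ.measurableSet, heq, integral_sub hIw hIv, hw1, hv1, sub_zero]

/-! ### Jets on coincidence sets -/

/-- The derivative of a function vanishes almost everywhere on its zero set. The proof applies the
corresponding fact for maps `ℝⁿ → ℝⁿ` approximated by the zero map to `f e`, for a unit vector `e`;
this needs `1 ≤ n`. -/
theorem ae_fderiv_eq_zero (hn : 1 ≤ n) {s : Set (Sp n)} (hs : MeasurableSet s) {f : Sp n → ℝ}
    (hd : ∀ x ∈ s, DifferentiableAt ℝ f x) (h0 : ∀ x ∈ s, f x = 0) :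
    ∀ᵐ x ∂volume.restrict s, fderiv ℝ f x = 0 := by
  set e : Sp n := EuclideanSpace.single ⟨0, hn⟩ 1 with he
  have hF : ApproximatesLinearOn (fun x => f x • e) (0 : Sp n →L[ℝ] Sp n) s 0 :=
    fun x hx y hy => by simp [h0 x hx, h0 y hy]
  have h := hF.norm_fderiv_sub_le volume hs (fun x => (fderiv ℝ f x).smulRight e) fun x hx =>
    ((hd x hx).hasFDerivAt.smul_const e).hasFDerivWithinAt
  filter_upwards [h] with x hx
  rw [sub_zero, nonpos_iff_eq_zero, nnnorm_eq_zero] at hx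
  ext y
  have h1 := congrArg (fun L : Sp n →L[ℝ] Sp n => L y ⟨0, hn⟩) hx
  simpa [he] using h1

/-- Two functions of class `C²` have the same 2-jets almost everywhere on the set where they
coincide. -/
theorem ae_jet_eq (hn : 1 ≤ n) {Ω : Set (Sp n)} (hΩ : IsOpen Ω) {u v : Sp n → ℝ}
    (hu : ContDiffOn ℝ 2 u Ω) (hv : ContDiffOn ℝ 2 v Ω) (k : ℕ) (α : ℝ) :
    ∀ᵐ x ∂volume.restrict Ω, u x = v x → jet k α u x = jet k α v x := by
  have h1 : ∀ {f : Sp n → ℝ}, ContDiffOn ℝ 1 f Ω →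
      ∀ᵐ x ∂volume.restrict Ω, f x = 0 → fderiv ℝ f x = 0 := fun {f} hf => by
    have hm : MeasurableSet (Ω ∩ f ⁻¹' {0}) := by
      have ho : IsOpen (Ω ∩ f ⁻¹' {0}ᶜ) :=
        hf.continuousOn.isOpen_inter_preimage hΩ isOpen_compl_singleton
      have : Ω ∩ f ⁻¹' {0} = Ω \ (Ω ∩ f ⁻¹' {0}ᶜ) := by
        ext x; simp only [mem_inter_iff, mem_preimage, mem_singleton_iff, Set.mem_sdiff,
          mem_compl_iff]
        tauto
      rw [this]
      exact hΩ.measurableSet.diff ho.measurableSet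
    have h := ae_fderiv_eq_zero hn hm (fun x hx =>
      (hf.differentiableOn one_ne_zero).differentiableAt (hΩ.mem_nhds hx.1)) fun x hx => hx.2
    rw [ae_restrict_iff' hm] at h
    rw [ae_restrict_iff' hΩ.measurableSet]
    filter_upwards [h] with x hx hxΩ hx0
    exact hx ⟨hxΩ, hx0⟩
  have hφ : ContDiffOn ℝ 2 (fun x => u x - v x) Ω := hu.sub hv
  have hpu (i) : ContDiffOn ℝ 1 (pd i u) Ω :=
    contDiffOn_pd hΩ (by rw [one_add_one_eq_two]; exact hu) i
  have hpv (i) : ContDiffOn ℝ 1 (pd i v) Ω :=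
    contDiffOn_pd hΩ (by rw [one_add_one_eq_two]; exact hv) i
  have hA := h1 (hφ.of_le (m := 1) (by norm_num))
  have hB := fun i => h1 ((hpu i).sub (hpv i))
  rw [← ae_all_iff] at hB
  filter_upwards [hA, hB, ae_restrict_mem hΩ.measurableSet] with x hxA hxB hx heq
  have hsub : ∀ {f g : Sp n → ℝ}, ContDiffOn ℝ 1 f Ω → ContDiffOn ℝ 1 g Ω →
      fderiv ℝ (fun y => f y - g y) x = 0 → fderiv ℝ f x = fderiv ℝ g x := fun hf hg h => by
    have hfd := (hf.differentiableOn one_ne_zero).differentiableAt (hΩ.mem_nhds hx)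
    have hgd := (hg.differentiableOn one_ne_zero).differentiableAt (hΩ.mem_nhds hx)
    rw [fderiv_fun_sub hfd hgd, sub_eq_zero] at h
    exact h
  have hD : fderiv ℝ u x = fderiv ℝ v x :=
    hsub (hu.of_le (by norm_num)) (hv.of_le (by norm_num)) (hxA (sub_eq_zero.mpr heq))
  have hG : gradient u x = gradient v x := by rw [gradient, gradient, hD]
  have hH : hessian u x = hessian v x := by
    ext i j
    have hi : pd i u x = pd i v x := by rw [pd, pd, hD]
    rw [hessian_apply, hessian_apply, pd, pd,
      hsub (hpu i) (hpv i) (hxB i (by simp [hi]))]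
  rw [jet, jet, heq, hG, hH]

/-! ### Approximate ellipticity -/

theorem continuousOn_jetPsi {X : Type*} [TopologicalSpace X] (k : ℕ) {α : ℝ} (hα : 0 ≤ α)
    {s : Set X} {f : X → ℝ} {p : X → Sp n} {r : X → Matrix (Fin n) (Fin n) ℝ}
    (hf : ContinuousOn f s) (hp : ContinuousOn p s) (hr : ContinuousOn r s) :
    ContinuousOn (fun x => jetPsi k α (f x) (p x) (r x)) s := by
  refine (hf.rpow_const fun x _ => Or.inr hα).mul (continuousOn_finsetSum _ fun l _ => ?_)
  refine (continuousOn_const.mul ((hp.norm.pow 2).pow l)).mul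
    ((continuous_sig _).comp_continuousOn ?_)
  exact (hf.smul hr).sub ((continuousOn_const.mul (hp.norm.pow 2)).smul continuousOn_const)

/-- The divided difference of `rankOneCoeff` in its first argument. -/
def rankOneDiff (k : ℕ) (α w w' q : ℝ) (r : Matrix (Fin n) (Fin n) ℝ) (z : Fin n → ℝ) : ℝ :=
  ∑ m ∈ Finset.range k, cCoeff k α (m + 1) *
    (∑ i ∈ Finset.range (m + 1), w ^ i * w' ^ (m - i)) * q ^ (k - (m + 1)) * tau m r z z

theorem rankOneCoeff_sub (k : ℕ) (α w w' q : ℝ) (r : Matrix (Fin n) (Fin n) ℝ)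
    (z : Fin n → ℝ) : rankOneCoeff k α w q r z - rankOneCoeff k α w' q r z =
      (w - w') * rankOneDiff k α w w' q r z := by
  rw [rankOneCoeff, rankOneCoeff, rankOneDiff, ← Finset.sum_sub_distrib, Finset.mul_sum]
  refine Finset.sum_congr rfl fun m _ => ?_
  have h := geom_sum₂_mul w w' (m + 1)
  rw [Nat.add_sub_cancel] at h
  linear_combination (-(cCoeff k α (m + 1) * q ^ (k - (m + 1)) * tau m r z z)) * h

theorem continuousOn_rankOneDiff {X : Type*} [TopologicalSpace X] (k : ℕ) (α : ℝ)
    {s : Set X} {f g q : X → ℝ} {r : X → Matrix (Fin n) (Fin n) ℝ} {z : X → Fin n → ℝ}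
    (hf : ContinuousOn f s) (hg : ContinuousOn g s) (hq : ContinuousOn q s)
    (hr : ContinuousOn r s) (hz : ContinuousOn z s) :
    ContinuousOn (fun x => rankOneDiff k α (f x) (g x) (q x) (r x) (z x)) s := by
  have hrz : ContinuousOn (fun x => (r x, z x, z x)) s := hr.prodMk (hz.prodMk hz)
  have htau (m : ℕ) : ContinuousOn (fun x => tau m (r x) (z x) (z x)) s :=
    (continuous_tau m).comp_continuousOn (f := fun x => (r x, z x, z x)) hrz
  have hsum (m : ℕ) : ContinuousOn
      (fun x => ∑ i ∈ Finset.range (m + 1), f x ^ i * g x ^ (m - i)) s :=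
    continuousOn_finsetSum _ fun i _ => (hf.pow i).mul (hg.pow (m - i))
  have hterm (m : ℕ) : ContinuousOn (fun x => cCoeff k α (m + 1) *
      (∑ i ∈ Finset.range (m + 1), f x ^ i * g x ^ (m - i)) * q x ^ (k - (m + 1)) *
        tau m (r x) (z x) (z x)) s :=
    ((continuousOn_const.mul (hsum m)).mul (hq.pow _)).mul (htau m)
  unfold rankOneDiff
  exact continuousOn_finsetSum _ fun m _ => hterm m

/-- Approximate ellipticity: if `(w', p, r)` is admissible, then adding a nonnegative multiple
`c z ⊗ z` to `r` decreases the integrand at `(w, p, r)` by at most a multiple of `c |w - w'|`. -/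
theorem JetAdm.jetPsi_sub_le {k : ℕ} (hk : 1 ≤ k) (hkn : k ≤ n) {α : ℝ} (hα : 0 ≤ α)
    {w w' : ℝ} {p : Sp n} {r : Matrix (Fin n) (Fin n) ℝ} (h : JetAdm k w' p r) (hw : 0 ≤ w)
    {c : ℝ} (hc : 0 ≤ c) (z : Fin n → ℝ) :
    jetPsi k α w p r - c * |w - w'| * |w ^ α * rankOneDiff k α w w' (‖p‖ ^ 2) r z| ≤
      jetPsi k α w p (r + c • vecMulVec z z) := by
  have h0 := h.rankOneCoeff_nonneg hk hkn hα z
  have h1 := rankOneCoeff_sub k α w w' (‖p‖ ^ 2) r z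
  have hwα : 0 ≤ w ^ α := Real.rpow_nonneg hw α
  rw [jetPsi, jetPsi, Psi_add_vecMulVec hk hkn hα, eq_add_of_sub_eq h1]
  set D := rankOneDiff k α w w' (‖p‖ ^ 2) r z
  have h2 : -(|w - w'| * |w ^ α * D|) ≤ (w - w') * (w ^ α * D) := by
    rw [← abs_mul]; exact neg_abs_le _
  have h3 := mul_le_mul_of_nonneg_left h2 hc
  have h4 := mul_nonneg (mul_nonneg hwα hc) h0
  linear_combination h3 + h4

/-! ### Jets of compositions with the difference of two functions -/

section Composition

variable {Ω : Set (Sp n)} {u v : Sp n → ℝ} {F F1 F2 : ℝ → ℝ}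

theorem pd_add_comp_sub (hΩ : IsOpen Ω) (hu : ContDiffOn ℝ 1 u Ω) (hv : ContDiffOn ℝ 1 v Ω)
    (hF : ∀ s, HasDerivAt F (F1 s) s) {x : Sp n} (hx : x ∈ Ω) (i : Fin n) :
    pd i (fun y => v y + F (u y - v y)) x =
      pd i v x + F1 (u x - v x) * (pd i u x - pd i v x) := by
  have hu' := ((hu.differentiableOn one_ne_zero).differentiableAt (hΩ.mem_nhds hx)).hasFDerivAt
  have hv' := ((hv.differentiableOn one_ne_zero).differentiableAt (hΩ.mem_nhds hx)).hasFDerivAt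
  have h := hv'.add ((hF (u x - v x)).comp_hasFDerivAt x (hu'.sub hv'))
  have h2 : HasFDerivAt (fun y => v y + F (u y - v y)) _ x := h
  rw [pd, h2.fderiv]
  rfl

theorem pd_pd_add_comp_sub (hΩ : IsOpen Ω) (hu : ContDiffOn ℝ 2 u Ω) (hv : ContDiffOn ℝ 2 v Ω)
    (hF : ∀ s, HasDerivAt F (F1 s) s) (hF1 : ∀ s, HasDerivAt F1 (F2 s) s) {x : Sp n}
    (hx : x ∈ Ω) (i j : Fin n) :
    pd j (pd i fun y => v y + F (u y - v y)) x =
      pd j (pd i v) x + F1 (u x - v x) * (pd j (pd i u) x - pd j (pd i v) x) +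
        F2 (u x - v x) * ((pd i u x - pd i v x) * (pd j u x - pd j v x)) := by
  have hu1 : ContDiffOn ℝ 1 u Ω := hu.of_le (by norm_num)
  have hv1 : ContDiffOn ℝ 1 v Ω := hv.of_le (by norm_num)
  have hpu : ContDiffOn ℝ 1 (pd i u) Ω := contDiffOn_pd hΩ (by rw [one_add_one_eq_two]; exact hu) i
  have hpv : ContDiffOn ℝ 1 (pd i v) Ω := contDiffOn_pd hΩ (by rw [one_add_one_eq_two]; exact hv) i
  have hd : ∀ {f : Sp n → ℝ}, ContDiffOn ℝ 1 f Ω → HasFDerivAt f (fderiv ℝ f x) x := fun {f} hf =>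
    ((hf.differentiableOn one_ne_zero).differentiableAt (hΩ.mem_nhds hx)).hasFDerivAt
  have heq : (pd i fun y => v y + F (u y - v y)) =ᶠ[𝓝 x]
      fun y => pd i v y + F1 (u y - v y) * (pd i u y - pd i v y) := by
    filter_upwards [hΩ.mem_nhds hx] with y hy
    exact pd_add_comp_sub hΩ hu1 hv1 hF hy i
  have h : HasFDerivAt (fun y => pd i v y + F1 (u y - v y) * (pd i u y - pd i v y)) _ x :=
    (hd hpv).add (((hF1 (u x - v x)).comp_hasFDerivAt x ((hd hu1).sub (hd hv1))).mul
      ((hd hpu).sub (hd hpv)))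
  rw [pd, heq.fderiv_eq, h.fderiv]
  simp only [_root_.add_apply, _root_.smul_apply,
    _root_.sub_apply, smul_eq_mul, Function.comp_apply, Pi.sub_apply]
  simp only [pd]
  ring

theorem gradient_add_comp_sub (hΩ : IsOpen Ω) (hu : ContDiffOn ℝ 2 u Ω) (hv : ContDiffOn ℝ 2 v Ω)
    (hF : ∀ s, HasDerivAt F (F1 s) s) {x : Sp n} (hx : x ∈ Ω) :
    gradient (fun y => v y + F (u y - v y)) x =
      (1 - F1 (u x - v x)) • gradient v x + F1 (u x - v x) • gradient u x := by
  ext i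
  rw [gradient_apply, pd_add_comp_sub hΩ (hu.of_le (by norm_num)) (hv.of_le (by norm_num)) hF hx]
  simp only [PiLp.add_apply, PiLp.smul_apply, smul_eq_mul, gradient_apply]
  ring

theorem hessian_add_comp_sub (hΩ : IsOpen Ω) (hu : ContDiffOn ℝ 2 u Ω) (hv : ContDiffOn ℝ 2 v Ω)
    (hF : ∀ s, HasDerivAt F (F1 s) s) (hF1 : ∀ s, HasDerivAt F1 (F2 s) s) {x : Sp n}
    (hx : x ∈ Ω) :
    hessian (fun y => v y + F (u y - v y)) x =
      ((1 - F1 (u x - v x)) • hessian v x + F1 (u x - v x) • hessian u x) +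
        F2 (u x - v x) • vecMulVec (⇑(gradient u x - gradient v x))
          (⇑(gradient u x - gradient v x)) := by
  ext i j
  rw [hessian_apply, pd_pd_add_comp_sub hΩ hu hv hF hF1 hx]
  simp only [Matrix.add_apply, Matrix.smul_apply, smul_eq_mul, vecMulVec_apply, PiLp.sub_apply,
    gradient_apply, hessian_apply]
  ring

end Composition

/-! ### Comparison of the integrals -/

theorem C2Closure.integrableOn_jet {Ω : Set (Sp n)} (hΩ : IsOpen Ω)
    (hΩb : Bornology.IsBounded Ω) {u : Sp n → ℝ} (hu : C2Closure Ω u) (k : ℕ) {α : ℝ}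
    (hα : 0 ≤ α) : IntegrableOn (jet k α u) Ω := by
  obtain ⟨g, hg, hgu⟩ := hu.gradient_extends
  obtain ⟨H, hH, hHu⟩ := hu.hessian_extends
  have h := ((continuousOn_jetPsi k hα hu.continuousOn hg hH).integrableOn_compact
    (μ := volume) hΩb.isCompact_closure).mono_set subset_closure
  refine h.congr_fun (fun x hx => ?_) hΩ.measurableSet
  simp only [jet, hgu hx, hHu hx]

/-- The interpolation `v + ramp (N (u - v)) / N` between `v` and `u`. -/
def interp (u v : Sp n → ℝ) (N : ℝ) (x : Sp n) : ℝ := v x + ramp (N * (u x - v x)) / N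

/-- The integrand at the jet of `interp u v N` without its rank-one part: the gradient and the
Hessian are replaced by the convex combinations of those of `u` and `v` with weight
`rampDeriv (N (u - v))`. -/
def interpJet (k : ℕ) (α : ℝ) (u v : Sp n → ℝ) (N : ℝ) (x : Sp n) : ℝ :=
  jetPsi k α (interp u v N x)
    ((1 - rampDeriv (N * (u x - v x))) • gradient v x +
      rampDeriv (N * (u x - v x)) • gradient u x)
    ((1 - rampDeriv (N * (u x - v x))) • hessian v x +
      rampDeriv (N * (u x - v x)) • hessian u x)

/-- The error `c |w - w'|` in the ellipticity inequality `JetAdm.jetPsi_sub_le` for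
`interp u v N`, as a function of `s = N (u - v)`. It is bounded independently of `N`. -/
def rampError (s : ℝ) : ℝ := |rampDeriv2 s * (s * rampDeriv s - ramp s)|

theorem continuous_rampError : Continuous rampError :=
  (continuous_rampDeriv2.mul ((continuous_id.mul continuous_rampDeriv).sub continuous_ramp)).abs

section Comparison

variable {k : ℕ} {α : ℝ} {Ω : Set (Sp n)} {u v : Sp n → ℝ} {N : ℝ}

theorem interp_of_le {x : Sp n} (h : N * (u x - v x) ≤ 1) : interp u v N x = v x := by
  rw [interp, ramp_of_le h, zero_div, add_zero]

theorem hasDerivAt_ramp_mul_div (hN : 0 < N) (s : ℝ) :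
    HasDerivAt (fun s => ramp (N * s) / N) (rampDeriv (N * s)) s := by
  have h := ((hasDerivAt_ramp (N * s)).comp s ((hasDerivAt_id s).const_mul N)).div_const N
  rwa [mul_one, mul_div_cancel_right₀ _ hN.ne'] at h

theorem hasDerivAt_rampDeriv_mul (s : ℝ) :
    HasDerivAt (fun s => rampDeriv (N * s)) (rampDeriv2 (N * s) * N) s := by
  have h := (hasDerivAt_rampDeriv (N * s)).comp s ((hasDerivAt_id s).const_mul N)
  rwa [mul_one] at h

theorem contDiffOn_interp (hu : ContDiffOn ℝ 2 u Ω) (hv : ContDiffOn ℝ 2 v Ω) :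
    ContDiffOn ℝ 2 (interp u v N) Ω :=
  hv.add ((contDiff_ramp.comp_contDiffOn (contDiffOn_const.mul (hu.sub hv))).div_const N)

theorem interp_nonneg (hN : 0 < N) {x : Sp n} (hv : 0 ≤ v x) : 0 ≤ interp u v N x :=
  add_nonneg hv (div_nonneg (ramp_nonneg _) hN.le)

/-- The jet of `interp u v N`. The convexity of `ramp` gives a nonnegative rank-one part. -/
theorem jet_interp (hΩ : IsOpen Ω) (hu : ContDiffOn ℝ 2 u Ω) (hv : ContDiffOn ℝ 2 v Ω)
    (hN : 0 < N) {x : Sp n} (hx : x ∈ Ω) : jet k α (interp u v N) x =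
      jetPsi k α (interp u v N x)
        ((1 - rampDeriv (N * (u x - v x))) • gradient v x +
          rampDeriv (N * (u x - v x)) • gradient u x)
        (((1 - rampDeriv (N * (u x - v x))) • hessian v x +
          rampDeriv (N * (u x - v x)) • hessian u x) + (rampDeriv2 (N * (u x - v x)) * N) •
            vecMulVec (⇑(gradient u x - gradient v x)) (⇑(gradient u x - gradient v x))) := by
  have h1 := gradient_add_comp_sub hΩ hu hv (hasDerivAt_ramp_mul_div hN) hx
  have h2 := hessian_add_comp_sub hΩ hu hv (hasDerivAt_ramp_mul_div hN)
    hasDerivAt_rampDeriv_mul hx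
  rw [jet]
  exact congrArg₂ _ h1 h2

/-- The interpolations agree with `v` near the boundary, so all of them have the same integral. -/
theorem integral_jet_interp (hk : 1 ≤ k) (hkn : k ≤ n) (hα : 0 ≤ α) (hΩ : IsOpen Ω)
    (hΩb : Bornology.IsBounded Ω) (hu : C2Closure Ω u) (hv : C2Closure Ω v)
    (hv0 : ∀ x ∈ Ω, 0 ≤ v x) (hbd : ∀ x ∈ frontier Ω, u x = v x) (hN : 0 < N) :
    IntegrableOn (jet k α (interp u v N)) Ω ∧
      ∫ x in Ω, jet k α (interp u v N) x = ∫ x in Ω, jet k α v x := by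
  have hcl : ContinuousOn (fun x => N * (u x - v x)) (closure Ω) :=
    continuousOn_const.mul (hu.continuousOn.sub hv.continuousOn)
  have hK : IsCompact (closure Ω ∩ (fun x => N * (u x - v x)) ⁻¹' Ici 1) :=
    hΩb.isCompact_closure.of_isClosed_subset
      (hcl.preimage_isClosed_of_isClosed isClosed_closure isClosed_Ici) inter_subset_left
  have hKΩ : closure Ω ∩ (fun x => N * (u x - v x)) ⁻¹' Ici 1 ⊆ Ω := fun x hx => by
    by_contra hxΩ
    have h1 : u x = v x := hbd x (by rw [hΩ.frontier_eq]; exact ⟨hx.1, hxΩ⟩)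
    have h2 : (1 : ℝ) ≤ N * (u x - v x) := hx.2
    rw [h1, sub_self, mul_zero] at h2
    linarith
  have hIv := hv.integrableOn_jet hΩ hΩb k hα
  obtain ⟨h1, h2⟩ := integral_jet_sub_jet hk hkn hα hΩ hK hKΩ hv.contDiffOn
    (contDiffOn_interp (N := N) hu.contDiffOn hv.contDiffOn) hv0
    (fun x hx => interp_nonneg hN (hv0 x hx)) fun x hx hxK => by
      have hlt : N * (u x - v x) < 1 := not_le.mp fun h => hxK ⟨subset_closure hx, h⟩
      have hc := (hcl.mono subset_closure).continuousAt (hΩ.mem_nhds hx)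
      filter_upwards [hc.eventually_lt continuousAt_const hlt] with y hy
      exact interp_of_le hy.le
  have hI : IntegrableOn (jet k α (interp u v N)) Ω := by
    refine (h1.add hIv).congr (Eventually.of_forall fun x => ?_)
    simp
  refine ⟨hI, ?_⟩
  rw [integral_sub hI hIv] at h2
  linarith

/-- On a compact set of jets, the ellipticity error of the interpolations is controlled by
`rampError`, and the interpolated integrands are bounded. -/
theorem exists_interpJet_le (hk : 1 ≤ k) (hkn : k ≤ n) (hα : 0 ≤ α) (hΩ : IsOpen Ω)
    (hΩb : Bornology.IsBounded Ω) (hu : C2Closure Ω u) (hv : C2Closure Ω v)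
    (hju : ∀ x ∈ Ω, JetAdm k (u x) (gradient u x) (hessian u x))
    (hjv : ∀ x ∈ Ω, JetAdm k (v x) (gradient v x) (hessian v x))
    (huv : ∀ x ∈ Ω, v x ≤ u x) : ∃ C₁ C₂ : ℝ, ∀ N : ℝ, 0 < N → ∀ x ∈ Ω,
      |interpJet k α u v N x| ≤ C₁ ∧ interpJet k α u v N x - C₂ * rampError (N * (u x - v x)) ≤
        jet k α (interp u v N) x := by
  obtain ⟨gu, hgu, hgu'⟩ := hu.gradient_extends
  obtain ⟨gv, hgv, hgv'⟩ := hv.gradient_extends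
  obtain ⟨Hu, hHu, hHu'⟩ := hu.hessian_extends
  obtain ⟨Hv, hHv, hHv'⟩ := hv.hessian_extends
  have hcpt := hΩb.isCompact_closure
  obtain ⟨D, hD⟩ := hcpt.exists_bound_of_continuousOn (hu.continuousOn.sub hv.continuousOn)
  -- the jets which occur for some `N` lie in the image of this compact set
  set T : Set (Sp n × ℝ × ℝ) := closure Ω ×ˢ Icc 0 D ×ˢ Icc 0 1
  have hT : IsCompact T := hcpt.prod (isCompact_Icc.prod isCompact_Icc)
  have hm : MapsTo Prod.fst T (closure Ω) := fun y hy => hy.1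
  have hu₁ : ContinuousOn (fun y : Sp n × ℝ × ℝ => u y.1) T :=
    hu.continuousOn.comp continuous_fst.continuousOn hm
  have hv₁ : ContinuousOn (fun y : Sp n × ℝ × ℝ => v y.1) T :=
    hv.continuousOn.comp continuous_fst.continuousOn hm
  have hgu₁ : ContinuousOn (fun y : Sp n × ℝ × ℝ => gu y.1) T :=
    hgu.comp continuous_fst.continuousOn hm
  have hgv₁ : ContinuousOn (fun y : Sp n × ℝ × ℝ => gv y.1) T :=
    hgv.comp continuous_fst.continuousOn hm
  have hHu₁ : ContinuousOn (fun y : Sp n × ℝ × ℝ => Hu y.1) T :=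
    hHu.comp continuous_fst.continuousOn hm
  have hHv₁ : ContinuousOn (fun y : Sp n × ℝ × ℝ => Hv y.1) T :=
    hHv.comp continuous_fst.continuousOn hm
  have hθ : ContinuousOn (fun y : Sp n × ℝ × ℝ => y.2.2) T := continuous_snd.snd.continuousOn
  have hθ' : ContinuousOn (fun y : Sp n × ℝ × ℝ => 1 - y.2.2) T := continuousOn_const.sub hθ
  have hw : ContinuousOn (fun y : Sp n × ℝ × ℝ => v y.1 + y.2.1) T :=
    hv₁.add continuous_snd.fst.continuousOn
  have hw' : ContinuousOn (fun y : Sp n × ℝ × ℝ => (1 - y.2.2) * v y.1 + y.2.2 * u y.1) T :=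
    (hθ'.mul hv₁).add (hθ.mul hu₁)
  have hp : ContinuousOn (fun y : Sp n × ℝ × ℝ => (1 - y.2.2) • gv y.1 + y.2.2 • gu y.1) T :=
    (hθ'.smul hgv₁).add (hθ.smul hgu₁)
  have hr : ContinuousOn (fun y : Sp n × ℝ × ℝ => (1 - y.2.2) • Hv y.1 + y.2.2 • Hu y.1) T :=
    (hθ'.smul hHv₁).add (hθ.smul hHu₁)
  have hz : ContinuousOn (fun y : Sp n × ℝ × ℝ => ⇑(gu y.1 - gv y.1)) T :=
    (PiLp.continuous_ofLp 2 _).comp_continuousOn (hgu₁.sub hgv₁)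
  obtain ⟨C₁, hC₁⟩ := hT.exists_bound_of_continuousOn (continuousOn_jetPsi k hα hw hp hr)
  obtain ⟨C₂, hC₂⟩ := hT.exists_bound_of_continuousOn ((hw.rpow_const fun x _ => Or.inr hα).mul
    (continuousOn_rankOneDiff k α hw hw' (hp.norm.pow 2) hr hz))
  refine ⟨C₁, C₂, fun N hN x hx => ?_⟩
  have hφ : 0 ≤ N * (u x - v x) := mul_nonneg hN.le (sub_nonneg.mpr (huv x hx))
  have hmem : (x, ramp (N * (u x - v x)) / N, rampDeriv (N * (u x - v x))) ∈ T := by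
    refine ⟨subset_closure hx, ⟨div_nonneg (ramp_nonneg _) hN.le, ?_⟩, rampDeriv_nonneg _,
      rampDeriv_le_one _⟩
    rw [div_le_iff₀ hN, mul_comm D]
    exact (ramp_le hφ).trans
      (mul_le_mul_of_nonneg_left ((le_abs_self _).trans (hD x (subset_closure hx))) hN.le)
  have h1 := hC₁ _ hmem
  have h2 := hC₂ _ hmem
  simp only [Pi.mul_apply, Pi.pow_apply, hgu' hx, hgv' hx, hHu' hx, hHv' hx] at h1 h2
  refine ⟨h1, ?_⟩
  have hθ1 := rampDeriv_le_one (N * (u x - v x))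
  have hadm := (hjv x hx).combine hkn (hju x hx) (sub_nonneg.mpr hθ1)
    (rampDeriv_nonneg (N * (u x - v x)))
  have h3 := hadm.jetPsi_sub_le hk hkn hα (w := interp u v N x) (interp_nonneg hN (hjv x hx).1)
    (c := rampDeriv2 (N * (u x - v x)) * N) (mul_nonneg (rampDeriv2_nonneg _) hN.le)
    (gradient u x - gradient v x)
  rw [jet_interp hΩ hu.contDiffOn hv.contDiffOn hN hx, interpJet]
  refine le_trans (sub_le_sub_left ?_ _) h3
  have h4 : rampDeriv2 (N * (u x - v x)) * N * |interp u v N x -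
      ((1 - rampDeriv (N * (u x - v x))) * v x + rampDeriv (N * (u x - v x)) * u x)| =
      rampError (N * (u x - v x)) := by
    rw [rampError, abs_mul, abs_of_nonneg (rampDeriv2_nonneg _), mul_assoc]
    congr 1
    rw [← abs_of_pos hN, ← abs_mul, abs_of_pos hN, ← abs_neg, interp]
    congr 1
    field_simp
    ring
  rw [h4, mul_comm C₂]
  exact mul_le_mul_of_nonneg_left h2 (abs_nonneg _)

theorem tendsto_interp {x : Sp n} (h : v x < u x) :
    Tendsto (fun N : ℕ => interp u v (N + 1 : ℝ) x) atTop (𝓝 (u x)) := by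
  have h0 : Tendsto (fun N : ℕ => u x - 2 * (1 / ((N : ℝ) + 1))) atTop (𝓝 (u x - 2 * 0)) :=
    tendsto_const_nhds.sub (tendsto_one_div_add_atTop_nhds_zero_nat.const_mul 2)
  rw [mul_zero, sub_zero] at h0
  refine tendsto_of_tendsto_of_tendsto_of_le_of_le h0 tendsto_const_nhds (fun N => ?_) fun N => ?_
  · have hN : (0 : ℝ) < N + 1 := by positivity
    have h1 := le_ramp_add_two ((N + 1) * (u x - v x))
    have h2 : u x - v x ≤ (ramp ((N + 1) * (u x - v x)) + 2) / (N + 1) := by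
      rw [le_div_iff₀ hN]; linarith
    rw [add_div] at h2
    simp only [interp]
    rw [mul_one_div]
    linarith
  · have hN : (0 : ℝ) < N + 1 := by positivity
    have h1 := ramp_le (mul_nonneg hN.le (sub_nonneg.mpr h.le))
    have h2 : ramp ((N + 1) * (u x - v x)) / (N + 1) ≤ u x - v x := by
      rw [div_le_iff₀ hN]; linarith
    simp only [interp]
    linarith

/-- The minorants of the integrands of the interpolations converge to the integrand of `u`. -/
theorem tendsto_interpJet (hα : 0 ≤ α) {x : Sp n} (h : v x ≤ u x)
    (hjet : u x = v x → jet k α u x = jet k α v x) (C : ℝ) :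
    Tendsto (fun N : ℕ => interpJet k α u v (N + 1 : ℝ) x -
      C * rampError ((N + 1 : ℝ) * (u x - v x))) atTop (𝓝 (jet k α u x)) := by
  rcases h.eq_or_lt with h | h
  · rw [hjet h.symm]
    refine tendsto_const_nhds.congr fun N => ?_
    have h0 : ((N : ℝ) + 1) * (u x - v x) = 0 := by rw [h, sub_self, mul_zero]
    rw [interpJet, interp_of_le (by rw [h0]; exact zero_le_one), h0, rampError,
      rampDeriv_of_le zero_le_one, rampDeriv2_of_lt zero_lt_one, jet]
    simp
  · have hc : Continuous fun t : ℝ => jetPsi k α t (gradient u x) (hessian u x) :=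
      continuousOn_univ.mp (continuousOn_jetPsi k hα continuousOn_id continuousOn_const
        continuousOn_const)
    refine ((hc.tendsto (u x)).comp (tendsto_interp h)).congr' ?_
    have hinf : Tendsto (fun N : ℕ => ((N : ℝ) + 1) * (u x - v x)) atTop atTop :=
      (tendsto_atTop_add_const_right _ 1 tendsto_natCast_atTop_atTop).atTop_mul_const
        (sub_pos.mpr h)
    filter_upwards [hinf.eventually_gt_atTop 2] with N hN
    simp [interpJet, rampError, rampDeriv_of_ge hN.le, rampDeriv2_of_gt hN]

theorem continuousOn_interpJet (hα : 0 ≤ α) (hΩ : IsOpen Ω) (hu : ContDiffOn ℝ 2 u Ω)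
    (hv : ContDiffOn ℝ 2 v Ω) : ContinuousOn (interpJet k α u v N) Ω := by
  have hθ : ContinuousOn (fun x => rampDeriv (N * (u x - v x))) Ω :=
    continuous_rampDeriv.comp_continuousOn
      (continuousOn_const.mul (hu.continuousOn.sub hv.continuousOn))
  have hθ' : ContinuousOn (fun x => 1 - rampDeriv (N * (u x - v x))) Ω := continuousOn_const.sub hθ
  exact continuousOn_jetPsi k hα (contDiffOn_interp hu hv).continuousOn
    ((hθ'.smul (continuousOn_gradient hΩ (hv.of_le (by norm_num)))).add
      (hθ.smul (continuousOn_gradient hΩ (hu.of_le (by norm_num)))))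
    ((hθ'.smul (continuousOn_hessian hΩ hv)).add (hθ.smul (continuousOn_hessian hΩ hu)))

/-- The comparison principle for functions with admissible jets. -/
theorem setIntegral_jet_le (hk : 1 ≤ k) (hkn : k ≤ n) (hα : 0 ≤ α) (hΩ : IsOpen Ω)
    (hΩb : Bornology.IsBounded Ω) (hu : C2Closure Ω u) (hv : C2Closure Ω v)
    (hju : ∀ x ∈ Ω, JetAdm k (u x) (gradient u x) (hessian u x))
    (hjv : ∀ x ∈ Ω, JetAdm k (v x) (gradient v x) (hessian v x))
    (huv : ∀ x ∈ Ω, v x ≤ u x) (hbd : ∀ x ∈ frontier Ω, u x = v x) :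
    ∫ x in Ω, jet k α u x ≤ ∫ x in Ω, jet k α v x := by
  obtain ⟨C₁, C₂, hC⟩ := exists_interpJet_le hk hkn hα hΩ hΩb hu hv hju hjv huv
  obtain ⟨C₃, hC₃⟩ := exists_rampDeriv2_mul_le
  have hpos : ∀ N : ℕ, (0 : ℝ) < N + 1 := fun N => by positivity
  set R : ℕ → Sp n → ℝ := fun N x => interpJet k α u v (N + 1 : ℝ) x -
    C₂ * rampError ((N + 1 : ℝ) * (u x - v x))
  have hR : ∀ N, ContinuousOn (R N) Ω := fun N =>
    (continuousOn_interpJet hα hΩ hu.contDiffOn hv.contDiffOn).sub (continuousOn_const.mul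
      (continuous_rampError.comp_continuousOn (continuousOn_const.mul
        (hu.contDiffOn.continuousOn.sub hv.contDiffOn.continuousOn))))
  have hbound : ∀ N, ∀ x ∈ Ω, ‖R N x‖ ≤ C₁ + |C₂| * C₃ := fun N x hx => by
    refine (norm_sub_le _ _).trans (add_le_add (hC _ (hpos N) x hx).1 ?_)
    rw [norm_mul, Real.norm_eq_abs]
    refine mul_le_mul_of_nonneg_left ?_ (abs_nonneg _)
    rw [rampError, Real.norm_eq_abs, abs_abs]
    exact hC₃ _
  have hfin : IsFiniteMeasure (volume.restrict Ω) :=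
    isFiniteMeasure_restrict.mpr hΩb.measure_lt_top.ne
  have hbound' : ∀ N, ∀ᵐ x ∂volume.restrict Ω, ‖R N x‖ ≤ C₁ + |C₂| * C₃ := fun N =>
    (ae_restrict_mem hΩ.measurableSet).mono (hbound N)
  have hmeas : ∀ N, AEStronglyMeasurable (R N) (volume.restrict Ω) := fun N =>
    (hR N).aestronglyMeasurable hΩ.measurableSet
  have hlim : Tendsto (fun N => ∫ x in Ω, R N x) atTop (𝓝 (∫ x in Ω, jet k α u x)) := by
    refine tendsto_integral_of_dominated_convergence (fun _ => C₁ + |C₂| * C₃) hmeas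
      (integrable_const _) hbound' ?_
    filter_upwards [ae_jet_eq (hk.trans hkn) hΩ hu.contDiffOn hv.contDiffOn k α,
      ae_restrict_mem hΩ.measurableSet] with x hx hxΩ
    exact tendsto_interpJet hα (huv x hxΩ) hx C₂
  refine le_of_tendsto' hlim fun N => ?_
  obtain ⟨h1, h2⟩ := integral_jet_interp hk hkn hα hΩ hΩb hu hv (fun x hx => (hjv x hx).1) hbd
    (hpos N)
  rw [← h2]
  exact setIntegral_mono_on (Integrable.of_bound (hmeas N) _ (hbound' N)) h1 hΩ.measurableSet
    fun x hx => (hC _ (hpos N) x hx).2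

end Comparison

end Analysis

end SigmaYamabe

end

theorem theorem1p2 {n k : ℕ} (hk : 1 ≤ k) (hkn : k ≤ n)
    (Ω : Set (EuclideanSpace ℝ (Fin n))) (hΩ : IsOpen Ω) (hΩb : Bornology.IsBounded Ω)
    (u v : EuclideanSpace ℝ (Fin n) → ℝ)
    (hu : SigmaYamabe.Phi k Ω u) (hu2 : SigmaYamabe.C2Closure Ω u)
    (hv : SigmaYamabe.Phi k Ω v) (hv2 : SigmaYamabe.C2Closure Ω v)
    (huv : ∀ x ∈ Ω, v x ≤ u x) (hbd : ∀ x ∈ frontier Ω, u x = v x)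
    (α : ℝ) (hα : 0 ≤ α) :
    (∀ l, l ≤ k → 0 ≤ SigmaYamabe.b n k α l) ∧
    MeasureTheory.IntegrableOn (SigmaYamabe.psi k α u) Ω MeasureTheory.volume ∧
    MeasureTheory.IntegrableOn (SigmaYamabe.psi k α v) Ω MeasureTheory.volume ∧
    ∫ x in Ω, SigmaYamabe.psi k α u x ≤ ∫ x in Ω, SigmaYamabe.psi k α v x := by
  have heq : ∀ {w : EuclideanSpace ℝ (Fin n) → ℝ}, SigmaYamabe.C2Closure Ω w →
      EqOn (SigmaYamabe.jet k α w) (SigmaYamabe.psi k α w) Ω := fun hw x hx =>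
    (SigmaYamabe.psi_eq_jet hΩ hw.contDiffOn hx).symm
  refine ⟨fun l _ => SigmaYamabe.b_nonneg hk hkn hα l,
    (hu2.integrableOn_jet hΩ hΩb k hα).congr_fun (heq hu2) hΩ.measurableSet,
    (hv2.integrableOn_jet hΩ hΩb k hα).congr_fun (heq hv2) hΩ.measurableSet, ?_⟩
  rw [← setIntegral_congr_fun hΩ.measurableSet (heq hu2),
    ← setIntegral_congr_fun hΩ.measurableSet (heq hv2)]
  exact SigmaYamabe.setIntegral_jet_le hk hkn hα hΩ hΩb hu2 hv2
    (fun x hx => hu.jetAdm hkn hΩ hu2.contDiffOn hx)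
    (fun x hx => hv.jetAdm hkn hΩ hv2.contDiffOn hx) huv hbd
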